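/- Theorem (queueing model). Let $p,w,\gamma,\lambda,v>0$, $\beta>2$ and $r_\gamma=\left(\frac{p}{w\gamma}\right)^{1/\beta}$. Let $\Phi$ be a homogeneous Poisson point process of intensity $\lambda$ in $\mathbb R^2$ (the nodes), and let a user move along a straight line at constant speed $v$, starting from the origin at time $0$. Let $D(t)$ be the closed disc of radius $r_\gamma$ centred at the user's location at time $t$ (the straight motion being extended to all $t\in\mathbb R$) and let $K(t)=|\Phi\cap D(t)|$, $t\ge 0$. Then: (1) The process $(K(t),t\ge 0)$ is the process of the number of customers in a stationary $M/GI/\infty$ queue with arrival rate $2r_\gamma v\lambda$ and i.i.d. service times with density $$f(s)=\begin{cases}\dfrac{v^2 s}{2r_\gamma\sqrt{4r_\gamma^2-v^2s^2}} & s\in[0,2r_\gamma/v),\\[2mm] 0&\text{otherwise.}\end{cases}$$ That is, there are random variables $(T_n)_{n\in\mathbb Z}$ and $(S_n)_{n\in\mathbb Z}$, defined on the same probability space as $\Phi$, such that almost surely $\cdots<T_{-1}<T_0\le 0<T_1<T_2<\cdots$, the points $T_n$ form a Poisson process of rate $2r_\gamma v\lambda$ on $\mathbb R$ (the arrival times),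 the $S_n$ are i.i.d. with density $f$ and independent of $(T_n)_{n\in\mathbb Z}$ (the service times), and, almost surely, for all $t\ge 0$, $$K(t)=\#\{n\in\mathbb Z: T_n\le t\le T_n+S_n\}.$$ Moreover, the customers are the nodes that meet the moving disc: almost surely, these nodes can be enumerated without repetition as $(X_n)_{n\in\mathbb Z}$ in such a way that $\{t\in\mathbb R: X_n\in D(t)\}=[T_n,T_n+S_n]$ for all $n$, so that $T_n$ is the time at which $X_n$ enters the disc and $S_n$ is the time that it spends there. (2) The process $(K(t),t\ge 0)$ is stationary, and its stationary distribution is the Poisson distribution with mean $\lambda\pi r_\gamma^2$: $K(t)\sim\mathrm{Poisson}(\lambda\pi r_\gamma^2)$ for every $t\ge 0$. -/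

import Mathlib

open MeasureTheory ProbabilityTheory
open scoped NNReal

/-- The Poisson law of mean `m ≥ 0`, carried by the extended natural numbers
(where cardinalities of arbitrary sets take their values). -/
noncomputable def poissonENat (m : ℝ) : Measure ℕ∞ :=
  (poissonMeasure m.toNNReal).map (fun k : ℕ => (k : ℕ∞))

/-- A random set `Φ` of points is a homogeneous Poisson point process of intensity `c` (with
respect to the volume) under `P`: the number of points in every measurable set is a random
variable, it is Poisson with mean `c * volume B` for every measurable `B` of finite volume, and
the numbers of points in finitely many pairwise disjoint such sets are independent. -/
structure IsPoissonPointProcess {Ω E : Type*} [MeasurableSpace Ω] [MeasureSpace E]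
    (Φ : Ω → Set E) (c : ℝ) (P : Measure Ω) : Prop where
  measurable_count : ∀ B : Set E, MeasurableSet B → Measurable fun ω => (Φ ω ∩ B).encard
  hasLaw_count : ∀ B : Set E, MeasurableSet B → volume B ≠ ⊤ →
    HasLaw (fun ω => (Φ ω ∩ B).encard) (poissonENat (c * (volume B).toReal)) P
  indep_count : ∀ (n : ℕ) (B : Fin n → Set E), (∀ i, MeasurableSet (B i)) →
    (∀ i, volume (B i) ≠ ⊤) → Pairwise (fun i j => Disjoint (B i) (B j)) →
    iIndepFun (fun i ω => (Φ ω ∩ B i).encard) P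

/-- The `M/GI/∞` queue in its stationary regime, with arrival rate `α` and service time
distribution `μ`.  Customer `n` arrives at time `T n` and requires service for a time `S n`; the
customers are numbered in the order of arrival, customer `1` being the first one to arrive after
time `0`.  Arrivals form a Poisson process of rate `α` on the whole time axis, service times are
i.i.d. with law `μ`, and the sequence of service times is independent of the arrivals. -/
structure IsStationaryMGIInfinityQueue {Ω : Type*} [MeasurableSpace Ω]
    (T S : ℤ → Ω → ℝ) (α : ℝ) (μ : Measure ℝ) (P : Measure Ω) : Prop where
  measurable_arrival : ∀ n, Measurable (T n)
  measurable_service : ∀ n, Measurable (S n)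
  arrivals_ordered : ∀ᵐ ω ∂P, StrictMono (fun n => T n ω) ∧ T 0 ω ≤ 0 ∧ 0 < T 1 ω
  arrivals_poisson : IsPoissonPointProcess (fun ω => Set.range fun n => T n ω) α P
  service_law : ∀ n, HasLaw (S n) μ P
  service_indep : iIndepFun S P
  indep_arrival_service : IndepFun (fun ω n => T n ω) (fun ω n => S n ω) P

/-- The number of customers present at time `t` in a system with infinitely many servers: every
customer starts service on arrival, and is present from the arrival time `T n` to the departure
time `T n + S n`, both included. -/
noncomputable def numCustomers {Ω : Type*} (T S : ℤ → Ω → ℝ) (t : ℝ) (ω : Ω) : ℕ∞ :=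
  {n : ℤ | T n ω ≤ t ∧ t ≤ T n ω + S n ω}.encard

/-- The radius of coverage `r_γ = (p / (w γ)) ^ (1 / β)`. -/
noncomputable def coverageRadius (p w β γ : ℝ) : ℝ := (p / (w * γ)) ^ (1 / β)

/-- The closed disc of radius `r` centred at the location at time `t` of a user who is at the
origin at time `0` and moves with speed `v` in the direction of the unit vector `u`. -/
def movingDisc (u : EuclideanSpace ℝ (Fin 2)) (v r t : ℝ) : Set (EuclideanSpace ℝ (Fin 2)) :=
  Metric.closedBall ((v * t) • u) r

/-- The number `K t` of nodes in the moving disc at time `t`. -/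
noncomputable def nodeCount {Ω : Type*} (Φ : Ω → Set (EuclideanSpace ℝ (Fin 2)))
    (u : EuclideanSpace ℝ (Fin 2)) (v r t : ℝ) (ω : Ω) : ℕ∞ :=
  (Φ ω ∩ movingDisc u v r t).encard

/-- The service time density: `v² s / (2 r √(4 r² - v² s²))` on `[0, 2 r / v]`, and `0`
elsewhere. -/
noncomputable def serviceDensity (v r s : ℝ) : ℝ :=
  (Set.Icc 0 (2 * r / v)).indicator
    (fun s => v ^ 2 * s / (2 * r * √(4 * r ^ 2 - v ^ 2 * s ^ 2))) s

/-- The measure on the real line with density `serviceDensity v r`. -/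
noncomputable def serviceLaw (v r : ℝ) : Measure ℝ :=
  volume.withDensity fun s => ENNReal.ofReal (serviceDensity v r s)

/-! In orthonormal coordinates `(x, y)` with first axis along the motion, the disc meets exactly the
points of the strip `|y| ≤ r`. Such a point enters at time `(x - √(r² - y²)) / v` and stays for the
chord time `2√(r² - y²) / v`. For fixed `y` the entrance time is affine in `x` with slope `1 / v`,
and the chord time does not involve `x`. Hence planar Lebesgue measure on the strip is mapped to the
product of `2 r v` times Lebesgue measure with the law of the chord time at a uniform offset, which
is `serviceLaw` (`map_entranceTime_chordTime`). A Poisson process whose intensity is a product is a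
Poisson process of arrivals with i.i.d. independent marks, which is the queue.

The marking statement is `IsPoissonPointProcess.exists_isStationaryMGIInfinityQueue`. Almost surely
the points of the strip have distinct, locally finite and two-sided unbounded entrance times, so
they can be numbered by the integers (`ae_exists_enumeration`). The law of the numbered sequence
`(T, S)` is then identified through its counts in boxes `(a, b] × C`: these determine an ordered
sequence measurably (`exists_measurableSet_boxCount`), and their joint characteristic functions
agree with those of a model in which the marks are drawn independently (`integral_exp_box`,
`integral_exp_boxCount_prod`). Both sides come from the generating functional `E ∏ f(x) = exp (c ∫
(f - 1))` (`integral_finprod`).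

Stationarity follows from the same characteristic functions and translation invariance of volume;
the Poisson marginal is the law of the count in a disc of area `π r²`. -/

/-! ### Characters of Poisson counts. -/

section CountingCharacters

/-- The generating function of a Poisson variable. -/
lemma integral_pow_of_hasLaw_poissonENat {Ω : Type*} [MeasurableSpace Ω] {P : Measure Ω}
    {N : Ω → ℕ∞} {m : ℝ} (hm : 0 ≤ m) (hN : HasLaw N (poissonENat m) P) (z : ℂ) :
    ∫ ω, z ^ (N ω).toNat ∂P = Complex.exp (m * (z - 1)) := by
  have h1 : ∫ ω, z ^ (N ω).toNat ∂P = ∫ k, z ^ ENat.toNat k ∂(poissonENat m) :=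
    hN.integral_comp (f := fun k : ℕ∞ => z ^ k.toNat) .of_discrete
  rw [h1, poissonENat, integral_map .of_discrete .of_discrete, integral_poissonMeasure]
  have hm' : ((m.toNNReal : ℝ≥0) : ℝ) = m := Real.coe_toNNReal m hm
  simp only [hm', ENat.toNat_natCast]
  calc ∑' n : ℕ, (Real.exp (-m) * m ^ n / (n.factorial : ℝ)) • z ^ n
      = ∑' n : ℕ, (Real.exp (-m) : ℂ) * ((m * z) ^ n / (n.factorial : ℂ)) := by
        congr with n
        rw [Complex.real_smul]
        push_cast
        rw [mul_pow]
        ring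
    _ = (Real.exp (-m) : ℂ) * Complex.exp (m * z) := by
        rw [tsum_mul_left, (NormedSpace.expSeries_div_hasSum_exp ((m : ℂ) * z)).tsum_eq,
          Complex.exp_eq_exp_ℂ]
    _ = Complex.exp (m * (z - 1)) := by
        rw [Complex.ofReal_exp, ← Complex.exp_add]
        push_cast
        ring_nf

lemma ae_ne_top_of_hasLaw_poissonENat {Ω : Type*} [MeasurableSpace Ω] {P : Measure Ω}
    {N : Ω → ℕ∞} {m : ℝ} (hN : HasLaw N (poissonENat m) P) : ∀ᵐ ω ∂P, N ω ≠ ⊤ := by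
  rw [hN.ae_iff (p := fun k => k ≠ ⊤) .of_discrete, poissonENat,
    ae_map_iff .of_discrete (.of_discrete)]
  simp

/-- A character of a finite vector of cardinalities is a product over the points counted. -/
lemma exp_sum_encard_eq_finprod {κ ι : Type*} [Fintype ι] {A : Set κ} (hA : A.Finite)
    {B : ι → Set κ} (hB : ∀ j, B j ⊆ A) (θ : ι → ℝ) :
    Complex.exp ((∑ j, θ j * ((B j).encard.toNat : ℝ) : ℝ) * Complex.I) =
      ∏ᶠ x ∈ A, Complex.exp ((∑ j, θ j * (B j).indicator (1 : κ → ℝ) x : ℝ) * Complex.I) := by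
  classical
  rw [finprod_mem_eq_finite_toFinset_prod _ hA, ← Complex.exp_sum, ← Finset.sum_mul,
    ← Complex.ofReal_sum, Finset.sum_comm]
  congr 4
  funext j
  rw [← Finset.mul_sum]
  congr 1
  have : (B j).encard = ((hA.toFinset.filter (· ∈ B j)).card : ℕ∞) := by
    rw [← Set.encard_coe_eq_coe_finsetCard]
    congr 1
    ext x
    simpa using fun h => hB j h
  rw [this, ENat.toNat_natCast]
  simp [Set.indicator_apply]

lemma measurable_exp_sum_indicator {E ι : Type*} [MeasurableSpace E] [Fintype ι]
    {B : ι → Set E} (hB : ∀ j, MeasurableSet (B j)) (θ : ι → ℝ) :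
    Measurable fun x => Complex.exp ((∑ j, θ j * (B j).indicator (1 : E → ℝ) x : ℝ) *
      Complex.I) := by
  have h : ∀ j, Measurable ((B j).indicator (1 : E → ℝ)) := fun j =>
    measurable_one.indicator (hB j)
  fun_prop

/-- The value depends only on which of the finitely many `B j` contain the point. This makes the
character an admissible function for `integral_finprod`. -/
lemma finite_range_exp_sum_indicator {E ι : Type*} [Fintype ι] (B : ι → Set E) (θ : ι → ℝ) :
    (Set.range fun x => Complex.exp ((∑ j, θ j * (B j).indicator (1 : E → ℝ) x : ℝ) *
      Complex.I)).Finite := by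
  classical
  refine (Set.finite_range fun p : ι → Bool =>
    Complex.exp ((∑ j, θ j * (if p j then 1 else 0) : ℝ) * Complex.I)).subset ?_
  rintro _ ⟨x, rfl⟩
  exact ⟨fun j => decide (x ∈ B j), by simp [Set.indicator_apply]⟩

end CountingCharacters

/-! ### Generating functional and joint characteristic functions of a Poisson process. -/

namespace IsPoissonPointProcess

variable {Ω E : Type*} [MeasurableSpace Ω] [MeasureSpace E] {Φ : Ω → Set E} {c : ℝ}
  {P : Measure Ω}

lemma ae_finite (hΦ : IsPoissonPointProcess Φ c P) {W : Set E} (hW : MeasurableSet W)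
    (hW' : volume W ≠ ⊤) : ∀ᵐ ω ∂P, (Φ ω ∩ W).Finite := by
  filter_upwards [ae_ne_top_of_hasLaw_poissonENat (hΦ.hasLaw_count W hW hW')] with ω hω
  exact Set.encard_ne_top_iff.1 hω

lemma indep_count_fintype (hΦ : IsPoissonPointProcess Φ c P) {ι : Type*} [Fintype ι]
    {B : ι → Set E} (hB : ∀ i, MeasurableSet (B i)) (hB' : ∀ i, volume (B i) ≠ ⊤)
    (hd : Pairwise fun i j => Disjoint (B i) (B j)) :
    iIndepFun (fun i ω => (Φ ω ∩ B i).encard) P := by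
  have e := Fintype.equivFin ι
  have h := hΦ.indep_count _ (fun k => B (e.symm k)) (fun k => hB _) (fun k => hB' _)
    (fun i j hij => hd (e.symm.injective.ne hij))
  simpa using h.precomp e.injective

/-- The generating functional of a Poisson point process, at functions with finitely many
values. -/
lemma integral_finprod (hΦ : IsPoissonPointProcess Φ c P) (hc : 0 ≤ c) {W : Set E}
    (hW : MeasurableSet W) (hW' : volume W ≠ ⊤) {f : E → ℂ} (hf : Measurable f)
    (hfr : (Set.range f).Finite) :
    ∫ ω, ∏ᶠ x ∈ Φ ω ∩ W, f x ∂P = Complex.exp (c * ∫ x in W, (f x - 1)) := by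
  classical
  -- The level sets of `f` cut `W` into finitely many disjoint pieces with independent Poisson
  -- counts. Grouping points by the value of `f` turns the product over points into a product of
  -- powers `z ^ N`, whose means are known.
  let R : Finset ℂ := hfr.toFinset
  let B : R → Set E := fun z => W ∩ f ⁻¹' {(z : ℂ)}
  have hB : ∀ z, MeasurableSet (B z) := fun z => hW.inter (hf (measurableSet_singleton _))
  have hB' : ∀ z, volume (B z) ≠ ⊤ := fun z =>
    ne_top_of_le_ne_top hW' (measure_mono Set.inter_subset_left)
  have hd : Pairwise fun i j => Disjoint (B i) (B j) := by
    intro i j hij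
    refine Set.disjoint_left.2 fun x hx hx' => hij (Subtype.ext ?_)
    exact hx.2.symm.trans hx'.2
  have hind := hΦ.indep_count_fintype hB hB' hd
  have key : ∀ᵐ ω ∂P, ∏ᶠ x ∈ Φ ω ∩ W, f x = ∏ z : R, (z : ℂ) ^ (Φ ω ∩ B z).encard.toNat := by
    filter_upwards [hΦ.ae_finite hW hW'] with ω hω
    rw [finprod_mem_eq_finite_toFinset_prod _ hω,
      ← Finset.prod_fiberwise_of_maps_to (t := R) (g := f) (by simp [R]),
      ← Finset.prod_coe_sort R]
    refine Finset.prod_congr rfl fun z _ => ?_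
    have hcard : (Φ ω ∩ B z).encard =
        ((hω.toFinset.filter (fun x => f x = z)).card : ℕ∞) := by
      rw [← Set.encard_coe_eq_coe_finsetCard]
      congr 1
      ext x
      simp [B, and_assoc]
      tauto
    rw [hcard, ENat.toNat_natCast, Finset.prod_congr rfl (g := fun _ => (z : ℂ)) (by simp)]
    simp
  rw [integral_congr_ae key]
  have h2 := hind.integral_fun_prod_comp (f := fun (z : R) (k : ℕ∞) => (z : ℂ) ^ k.toNat)
    (fun z => (hΦ.measurable_count _ (hB z)).aemeasurable) (fun _ => .of_discrete)
  rw [h2]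
  have h3 : ∀ z : R, ∫ ω, (z : ℂ) ^ (Φ ω ∩ B z).encard.toNat ∂P =
      Complex.exp ((c * (volume (B z)).toReal : ℝ) * ((z : ℂ) - 1)) := fun z =>
    integral_pow_of_hasLaw_poissonENat (by positivity) (hΦ.hasLaw_count _ (hB z) (hB' z)) z
  simp_rw [h3, ← Complex.exp_sum]
  congr 1
  have : IsFiniteMeasure (volume.restrict W) := ⟨by simpa using hW'.lt_top⟩
  have hint : ∫ x in W, (f x - 1) =
      ∑ z : R, ((volume (B z)).toReal : ℂ) * ((z : ℂ) - 1) := by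
    have e1 : ∀ x, f x - 1 =
        ∑ z : R, (f ⁻¹' {(z : ℂ)}).indicator (fun _ => (z : ℂ) - 1) x := by
      intro x
      rw [Finset.sum_eq_single (⟨f x, by simp [R]⟩ : R)]
      · simp
      · intro z _ hz
        refine Set.indicator_of_notMem (fun h => hz (Subtype.ext ?_)) _
        exact h.symm
      · simp
    simp_rw [e1]
    have hm : ∀ z : ℂ, MeasurableSet (f ⁻¹' {z}) := fun z => hf (measurableSet_singleton z)
    rw [integral_finsetSum (μ := volume.restrict W) _
      fun (z : R) _ => (integrable_const ((z : ℂ) - 1)).indicator (hm z)]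
    refine Finset.sum_congr rfl fun z _ => ?_
    rw [integral_indicator_const _ (hm z), measureReal_restrict_apply (hm z), Set.inter_comm,
      Complex.real_smul]
    rfl
  rw [hint, Finset.mul_sum]
  refine Finset.sum_congr rfl fun z _ => ?_
  push_cast
  ring

/-- The joint characteristic function of the numbers of points in finitely many sets. -/
lemma integral_exp_count (hΦ : IsPoissonPointProcess Φ c P) (hc : 0 ≤ c) {ι : Type*} [Fintype ι]
    {B : ι → Set E} (hB : ∀ i, MeasurableSet (B i)) (hB' : ∀ i, volume (B i) ≠ ⊤) (θ : ι → ℝ) :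
    ∫ ω, Complex.exp ((∑ j, θ j * ((Φ ω ∩ B j).encard.toNat : ℝ) : ℝ) * Complex.I) ∂P =
      Complex.exp (c * ∫ x, (Complex.exp ((∑ j, θ j * (B j).indicator (1 : E → ℝ) x : ℝ) *
        Complex.I) - 1)) := by
  -- Off `W` the character equals `1`, so the integrand vanishes there and the generating functional
  -- on the finite-volume set `W` suffices.
  set W := ⋃ j, B j with hWdef
  have hW : MeasurableSet W := .iUnion hB
  have hW' : volume W ≠ ⊤ := by
    refine ne_top_of_le_ne_top ?_ (measure_iUnion_fintype_le volume B)
    exact ENNReal.sum_ne_top.2 fun j _ => hB' j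
  rw [← setIntegral_eq_integral_of_forall_compl_eq_zero (s := W),
    ← hΦ.integral_finprod hc hW hW' (measurable_exp_sum_indicator hB θ)
      (finite_range_exp_sum_indicator B θ)]
  · refine integral_congr_ae ?_
    filter_upwards [hΦ.ae_finite hW hW'] with ω hω
    rw [exp_sum_encard_eq_finprod (A := Φ ω ∩ W) (B := fun j => Φ ω ∩ B j) hω
      (fun j => Set.inter_subset_inter_right _ (Set.subset_iUnion B j))]
    refine finprod_mem_congr rfl fun x hx => ?_
    congr 4
    funext j
    by_cases h : x ∈ B j <;> simp [h, hx.1]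
  · intro x hx
    have : ∀ j, (B j).indicator (1 : E → ℝ) x = 0 := fun j =>
      Set.indicator_of_notMem (fun h => hx (Set.mem_iUnion.2 ⟨j, h⟩)) _
    simp [this]

end IsPoissonPointProcess

/-- Two families of almost surely finite counts with the same joint characteristic functions have
the same law. -/
lemma map_eq_of_integral_exp_toNat_eq {Ω Ω' κ : Type*} [MeasurableSpace Ω] [MeasurableSpace Ω']
    {P : Measure Ω} {P' : Measure Ω'} [IsProbabilityMeasure P] [IsProbabilityMeasure P']
    {X : Ω → κ → ℕ∞} {Y : Ω' → κ → ℕ∞} (hX : Measurable X) (hY : Measurable Y)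
    (hX' : ∀ k, ∀ᵐ ω ∂P, X ω k ≠ ⊤) (hY' : ∀ k, ∀ᵐ ω ∂P', Y ω k ≠ ⊤)
    (h : ∀ (J : Finset κ) (θ : J → ℝ),
      ∫ ω, Complex.exp ((∑ j, θ j * ((X ω j).toNat : ℝ) : ℝ) * Complex.I) ∂P =
        ∫ ω, Complex.exp ((∑ j, θ j * ((Y ω j).toNat : ℝ) : ℝ) * Complex.I) ∂P') :
    P.map X = P'.map Y := by
  classical
  have : IsProbabilityMeasure (P.map X) := Measure.isProbabilityMeasure_map hX.aemeasurable
  have : IsProbabilityMeasure (P'.map Y) := Measure.isProbabilityMeasure_map hY.aemeasurable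
  -- A law on a product space is determined by its finite-dimensional marginals.
  refine IsProjectiveLimit.unique (P := fun J : Finset κ => (P'.map Y).map J.restrict) ?_
    (fun J => rfl)
  intro J
  change _ = (P'.map Y).map J.restrict
  rw [Measure.map_map (by fun_prop) hX, Measure.map_map (by fun_prop) hY]
  -- Finite vectors of counts are embedded in a real vector space, where characteristic functions
  -- determine laws, and then decoded by the floor. Since `toNat` sends `⊤` to `0`, decoding
  -- recovers the counts only where they are finite, hence almost surely.
  let dec : (J → ℝ) → (J → ℕ∞) := fun v j => ((⌊v j⌋₊ : ℕ) : ℕ∞)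
  have hdec : Measurable dec := by
    refine measurable_pi_lambda _ fun j => ?_
    exact Measurable.of_discrete.comp (Nat.measurable_floor.comp (measurable_pi_apply j))
  let enX : Ω → (J → ℝ) := fun ω j => ((X ω j).toNat : ℝ)
  let enY : Ω' → (J → ℝ) := fun ω j => ((Y ω j).toNat : ℝ)
  have henX : Measurable enX := by
    refine measurable_pi_lambda _ fun j => ?_
    exact (Measurable.of_discrete (f := fun k : ℕ∞ => (k.toNat : ℝ))).comp
      ((measurable_pi_apply _).comp hX)
  have henY : Measurable enY := by
    refine measurable_pi_lambda _ fun j => ?_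
    exact (Measurable.of_discrete (f := fun k : ℕ∞ => (k.toNat : ℝ))).comp
      ((measurable_pi_apply _).comp hY)
  have hen : P.map enX = P'.map enY := by
    have : IsProbabilityMeasure (P.map enX) := Measure.isProbabilityMeasure_map henX.aemeasurable
    have : IsProbabilityMeasure (P'.map enY) := Measure.isProbabilityMeasure_map henY.aemeasurable
    refine Measure.ext_of_charFunDual (funext fun L => ?_)
    have hL : ∀ v : J → ℝ, L v = ∑ j, L (Pi.single j 1) * v j := by
      intro v
      conv_lhs => rw [pi_eq_sum_univ' v, map_sum]
      refine Finset.sum_congr rfl fun j _ => ?_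
      rw [map_smul, smul_eq_mul, mul_comm]
    rw [charFunDual_apply, charFunDual_apply, integral_map henX.aemeasurable (by fun_prop),
      integral_map henY.aemeasurable (by fun_prop)]
    have hX : ∀ ω, L (enX ω) = ∑ j : J, L (Pi.single j 1) * ((X ω j).toNat : ℝ) := fun ω => hL _
    have hY : ∀ ω, L (enY ω) = ∑ j : J, L (Pi.single j 1) * ((Y ω j).toNat : ℝ) := fun ω => hL _
    simp only [hX, hY]
    exact h J _
  have eX : J.restrict ∘ X =ᵐ[P] dec ∘ enX := by
    have : ∀ᵐ ω ∂P, ∀ j : J, X ω j ≠ ⊤ := ae_all_iff.2 fun j => hX' j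
    filter_upwards [this] with ω hω
    funext j
    simp [dec, enX, ENat.natCast_toNat (hω j)]
  have eY : J.restrict ∘ Y =ᵐ[P'] dec ∘ enY := by
    have : ∀ᵐ ω ∂P', ∀ j : J, Y ω j ≠ ⊤ := ae_all_iff.2 fun j => hY' j
    filter_upwards [this] with ω hω
    funext j
    simp [dec, enY, ENat.natCast_toNat (hω j)]
  rw [Measure.map_congr eX, Measure.map_congr eY, ← Measure.map_map hdec henX,
    ← Measure.map_map hdec henY, hen]

/-! ### Ordered enumerations and their determination by box counts. -/

section Enumeration

/-- A set of reals without accumulation points and unbounded in both directions can be enumerated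
increasingly by the integers, with index `1` for its first positive point. -/
lemma exists_strictMono_int_enumeration {A : Set ℝ} (hfin : ∀ a b, (A ∩ Set.Ioc a b).Finite)
    (hup : ∀ x, ∃ y ∈ A, x < y) (hdown : ∀ x, ∃ y ∈ A, y < x) :
    ∃ T : ℤ → ℝ, (StrictMono T ∧ T 0 ≤ 0 ∧ 0 < T 1) ∧ Set.range T = A := by
  classical
  have hIcc : ∀ a b : A, (Set.Icc a b).Finite := by
    intro a b
    refine Set.Finite.of_finite_image (f := Subtype.val) ?_ Subtype.val_injective.injOn
    -- The interval is open on the left; starting at `a - 1` keeps the point `a`.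
    refine (hfin (a - 1) b).subset ?_
    rintro _ ⟨x, ⟨hx1, hx2⟩, rfl⟩
    have h1 : (a : ℝ) ≤ x := hx1
    exact ⟨x.2, by linarith, hx2⟩
  let : LocallyFiniteOrder A := LocallyFiniteOrder.ofFiniteIcc hIcc
  let : SuccOrder A := LinearLocallyFiniteOrder.succOrder A
  let : PredOrder A := LinearLocallyFiniteOrder.predOrder A
  have : Nonempty A := let ⟨y, hy, _⟩ := hup 0; ⟨⟨y, hy⟩⟩
  have : NoMaxOrder A := ⟨fun a => let ⟨y, hy, h⟩ := hup a; ⟨⟨y, hy⟩, h⟩⟩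
  have : NoMinOrder A := ⟨fun a => let ⟨y, hy, h⟩ := hdown a; ⟨⟨y, hy⟩, h⟩⟩
  let e : ℤ ≃o A := orderIsoIntOfLinearSuccPredArch.symm
  have he : ∀ m n : ℤ, (e m : ℝ) < e n ↔ m < n := fun m n =>
    Subtype.coe_lt_coe.trans e.lt_iff_lt
  obtain ⟨y, hy, hy0⟩ := hup 0
  obtain ⟨z, hz, hz0⟩ := hdown 0
  -- The index of the last nonpositive point; shifting by `k` gives it index `0`.
  obtain ⟨k, hk, hk'⟩ := Int.exists_greatest_of_bdd (P := fun n => (e n : ℝ) ≤ 0)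
    ⟨e.symm ⟨y, hy⟩, fun n hn => by
      refine ((he n _).1 ?_).le
      simpa using lt_of_le_of_lt hn hy0⟩
    ⟨e.symm ⟨z, hz⟩, by simpa using hz0.le⟩
  refine ⟨fun n => e (n + k), ⟨fun m n hmn => (he _ _).2 (by lia), by simpa using hk, ?_⟩, ?_⟩
  · by_contra! h
    have := hk' _ h
    lia
  · ext x
    constructor
    · rintro ⟨n, rfl⟩
      exact (e _).2
    · exact fun hx => ⟨e.symm ⟨x, hx⟩ - k, by simp⟩

/-- The keys of half-open boxes `(a, b] × C`. -/
abbrev BoxKey : Type := ℝ × ℝ × {C : Set ℝ // MeasurableSet C}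

/-- The half-open box `(a, b] × C`. -/
def BoxKey.box (k : BoxKey) : Set (ℝ × ℝ) := Set.Ioc k.1 k.2.1 ×ˢ k.2.2.1

lemma BoxKey.measurableSet_box (k : BoxKey) : MeasurableSet k.box :=
  measurableSet_Ioc.prod k.2.2.2

/-- The number of marked points `(T n, S n)` in each box. -/
noncomputable def boxCount (T S : ℤ → ℝ) (k : BoxKey) : ℕ∞ :=
  {n : ℤ | (T n, S n) ∈ k.box}.encard

/-- The points in `(0, t]` are an initial segment of `T 1, T 2, …`. -/
lemma le_iff_le_boxCount {T S : ℤ → ℝ} (hT : StrictMono T) (h0 : T 0 ≤ 0) (h1 : 0 < T 1)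
    {n : ℕ} (hn : 1 ≤ n) (t : ℝ) :
    T n ≤ t ↔ (n : ℕ∞) ≤ boxCount T S (0, t, ⟨Set.univ, .univ⟩) := by
  constructor
  · intro h
    have hsub : Set.Icc (1 : ℤ) n ⊆ {k : ℤ | T k ∈ Set.Ioc 0 t ∧ S k ∈ Set.univ} := by
      rintro k ⟨hk1, hk2⟩
      exact ⟨⟨h1.trans_le (hT.monotone hk1), (hT.monotone hk2).trans h⟩, trivial⟩
    refine le_trans ?_ (Set.encard_le_encard hsub)
    rw [← Finset.coe_Icc, Set.encard_coe_eq_coe_finsetCard]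
    simp
  · intro h
    by_contra! hlt
    have hsub : {k : ℤ | T k ∈ Set.Ioc 0 t ∧ S k ∈ Set.univ} ⊆ Set.Icc (1 : ℤ) (n - 1 : ℤ) := by
      rintro k ⟨⟨hk1, hk2⟩, -⟩
      have a1 := hT.lt_iff_lt.1 (h0.trans_lt hk1)
      have a2 := hT.lt_iff_lt.1 (hk2.trans_lt hlt)
      exact ⟨by lia, by lia⟩
    have := h.trans (Set.encard_le_encard hsub)
    rw [← Finset.coe_Icc, Set.encard_coe_eq_coe_finsetCard, Nat.cast_le] at this
    simp at this
    lia

/-- The points in `(t, 0]` are an initial segment of `T 0, T (-1), …`, in which `T (-n)` comes in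
position `n + 1`. -/
lemma lt_iff_le_boxCount {T S : ℤ → ℝ} (hT : StrictMono T) (h0 : T 0 ≤ 0) (h1 : 0 < T 1)
    (n : ℕ) (t : ℝ) :
    t < T (-n) ↔ ((n + 1 : ℕ) : ℕ∞) ≤ boxCount T S (t, 0, ⟨Set.univ, .univ⟩) := by
  constructor
  · intro h
    have hsub : Set.Icc (-n : ℤ) 0 ⊆ {k : ℤ | T k ∈ Set.Ioc t 0 ∧ S k ∈ Set.univ} := by
      rintro k ⟨hk1, hk2⟩
      exact ⟨⟨h.trans_le (hT.monotone hk1), (hT.monotone hk2).trans h0⟩, trivial⟩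
    refine le_trans ?_ (Set.encard_le_encard hsub)
    rw [← Finset.coe_Icc, Set.encard_coe_eq_coe_finsetCard, Nat.cast_le]
    simp
  · intro h
    by_contra! hlt
    have hsub : {k : ℤ | T k ∈ Set.Ioc t 0 ∧ S k ∈ Set.univ} ⊆ Set.Icc (-n + 1 : ℤ) 0 := by
      rintro k ⟨⟨hk1, hk2⟩, -⟩
      have a1 := hT.lt_iff_lt.1 (hlt.trans_lt hk1)
      have a2 := hT.lt_iff_lt.1 (hk2.trans_lt h1)
      exact ⟨by lia, by lia⟩
    have := h.trans (Set.encard_le_encard hsub)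
    rw [← Finset.coe_Icc, Set.encard_coe_eq_coe_finsetCard, Nat.cast_le] at this
    simp at this

/-- Rationals `a`, `b` isolate `T n` from its neighbours, so only customer `n` can lie in `(a, b] ×
C`. Rational endpoints make the union countable, which gives measurability of the marks. -/
lemma mem_iff_exists_one_le_boxCount {T S : ℤ → ℝ} (hT : StrictMono T) (n : ℤ)
    (C : {C : Set ℝ // MeasurableSet C}) :
    S n ∈ C.1 ↔ ∃ a b : ℚ, T (n - 1) ≤ a ∧ (a : ℝ) < T n ∧ T n ≤ b ∧ (b : ℝ) < T (n + 1) ∧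
      1 ≤ boxCount T S (a, b, C) := by
  constructor
  · intro h
    obtain ⟨a, ha1, ha2⟩ := exists_rat_btwn (hT (show n - 1 < n by lia))
    obtain ⟨b, hb1, hb2⟩ := exists_rat_btwn (hT (show n < n + 1 by lia))
    refine ⟨a, b, ha1.le, ha2, hb1.le, hb2, ?_⟩
    rw [boxCount, Set.one_le_encard_iff_nonempty]
    exact ⟨n, ⟨ha2, hb1.le⟩, h⟩
  · rintro ⟨a, b, h1, h2, h3, h4, h5⟩
    rw [boxCount, Set.one_le_encard_iff_nonempty] at h5
    obtain ⟨k, ⟨hk1, hk2⟩, hk3⟩ := h5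
    have a1 := hT.lt_iff_lt.1 (h1.trans_lt hk1)
    have a2 := hT.lt_iff_lt.1 (hk2.trans_lt h4)
    obtain rfl : k = n := by lia
    exact hk3

/-- Events about a marked sequence of ordered points are events about its box counts. -/
lemma exists_measurableSet_boxCount {A : Set ((ℤ → ℝ) × (ℤ → ℝ))} (hA : MeasurableSet A) :
    ∃ D : Set (BoxKey → ℕ∞), MeasurableSet D ∧ ∀ T S : ℤ → ℝ,
      (StrictMono T ∧ T 0 ≤ 0 ∧ 0 < T 1) → ((T, S) ∈ A ↔ boxCount T S ∈ D) := by
  -- Ordered sequences carry the σ-algebra generated by the box counts alone. Once every `T n` and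
  -- `S n` is measurable for it, any event is by definition the preimage under `N` of a measurable
  -- set.
  let O := {o : (ℤ → ℝ) × (ℤ → ℝ) // StrictMono o.1 ∧ o.1 0 ≤ 0 ∧ 0 < o.1 1}
  let N : O → BoxKey → ℕ∞ := fun o => boxCount o.1.1 o.1.2
  let mO : MeasurableSpace O := MeasurableSpace.comap N inferInstance
  have hN : Measurable N := comap_measurable N
  have hk : ∀ (k : BoxKey) (m : ℕ∞), MeasurableSet {o : O | m ≤ N o k} := fun k m =>
    ((measurable_pi_apply k).comp hN) (MeasurableSet.of_discrete (s := Set.Ici m))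
  have hT : ∀ n : ℤ, Measurable fun o : O => o.1.1 n := by
    intro n
    rcases le_or_gt 1 n with hn | hn
    · obtain ⟨m, rfl⟩ := Int.eq_ofNat_of_zero_le (show 0 ≤ n by lia)
      refine measurable_of_Iic fun t => ?_
      convert hk (0, t, ⟨Set.univ, .univ⟩) m using 1
      ext o
      exact le_iff_le_boxCount o.2.1 o.2.2.1 o.2.2.2 (by lia) t
    · obtain ⟨m, hm⟩ := Int.eq_ofNat_of_zero_le (show 0 ≤ -n by lia)
      obtain rfl : n = -(m : ℤ) := by lia
      refine measurable_of_Ioi fun t => ?_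
      convert hk (t, 0, ⟨Set.univ, .univ⟩) ((m + 1 : ℕ) : ℕ∞) using 1
      ext o
      exact lt_iff_le_boxCount o.2.1 o.2.2.1 o.2.2.2 m t
  have hS : ∀ n : ℤ, Measurable fun o : O => o.1.2 n := by
    intro n C hC
    have : (fun o : O => o.1.2 n) ⁻¹' C = ⋃ (a : ℚ) (b : ℚ),
        {o : O | o.1.1 (n - 1) ≤ a} ∩ {o : O | (a : ℝ) < o.1.1 n} ∩ {o : O | o.1.1 n ≤ b} ∩
          {o : O | (b : ℝ) < o.1.1 (n + 1)} ∩ {o : O | 1 ≤ N o (a, b, ⟨C, hC⟩)} := by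
      ext o
      simp only [Set.mem_preimage, Set.mem_iUnion, Set.mem_inter_iff, Set.mem_ofPred_eq, and_assoc]
      exact mem_iff_exists_one_le_boxCount o.2.1 n ⟨C, hC⟩
    rw [this]
    refine .iUnion fun a => .iUnion fun b => ?_
    exact ((((measurableSet_le (hT _) measurable_const).inter
      (measurableSet_lt measurable_const (hT _))).inter
      (measurableSet_le (hT _) measurable_const)).inter
      (measurableSet_lt measurable_const (hT _))).inter (hk _ _)
  have hval : Measurable fun o : O => o.1 :=
    (measurable_pi_lambda _ hT).prodMk (measurable_pi_lambda _ hS)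
  obtain ⟨D, hD, hD'⟩ := hval hA
  refine ⟨D, hD, fun T S h => ?_⟩
  exact (Set.ext_iff.1 hD' ⟨(T, S), h⟩).symm

/-- The number of indices at which a measurable condition holds is measurable. -/
lemma measurable_encard_setOf {Ω ι : Type*} [MeasurableSpace Ω] [Countable ι]
    {p : ι → Ω → Prop} (hp : ∀ n, MeasurableSet {ω | p n ω}) :
    Measurable fun ω => {n | p n ω}.encard := by
  have h : ∀ m : ℕ, MeasurableSet {ω | (m : ℕ∞) ≤ {n | p n ω}.encard} := by
    intro m
    -- At least `m` indices qualify exactly when all members of some `m`-element set do, and there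
    -- are countably many such sets.
    have : {ω | (m : ℕ∞) ≤ {n | p n ω}.encard} =
        ⋃ F : {F : Finset ι // F.card = m}, ⋂ n ∈ F.1, {ω | p n ω} := by
      ext ω
      simp only [Set.mem_ofPred_eq, Set.mem_iUnion, Set.mem_iInter]
      constructor
      · intro h
        obtain ⟨t, ht, htm⟩ := Set.exists_subset_encard_eq h
        have hfin : t.Finite := Set.finite_of_encard_eq_coe htm
        refine ⟨⟨hfin.toFinset, ?_⟩, fun n hn => ht (by simpa using hn)⟩
        rw [hfin.encard_eq_coe_toFinset_card] at htm
        exact_mod_cast htm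
      · rintro ⟨F, hF⟩
        rw [← F.2, ← Set.encard_coe_eq_coe_finsetCard]
        exact Set.encard_le_encard hF
    rw [this]
    exact .iUnion fun F => .biInter F.1.countable_toSet fun n _ => hp n
  refine measurable_to_countable' fun k => ?_
  induction k using ENat.recTopCoe with
  | top =>
    convert MeasurableSet.iInter h using 1
    ext ω
    simp only [Set.mem_preimage, Set.mem_singleton_iff, Set.mem_iInter, Set.mem_ofPred_eq]
    exact ⟨fun h => by simp [h], fun h => ENat.eq_top_iff_forall_ge.2 h⟩
  | coe k =>
    convert (h k).diff (h (k + 1)) using 1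
    ext ω
    simp only [Set.mem_preimage, Set.mem_singleton_iff, Set.mem_sdiff, Set.mem_ofPred_eq, not_le]
    constructor
    · intro h
      rw [h]
      exact ⟨le_rfl, by exact_mod_cast Nat.lt_succ_self k⟩
    · rintro ⟨h1, h2⟩
      refine le_antisymm ?_ h1
      push_cast at h2
      exact Order.le_of_lt_add_one h2

lemma measurable_boxCount {Ω : Type*} [MeasurableSpace Ω] {T S : Ω → ℤ → ℝ} (hT : Measurable T)
    (hS : Measurable S) : Measurable fun ω => boxCount (T ω) (S ω) := by
  refine measurable_pi_lambda _ fun k => measurable_encard_setOf fun n => ?_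
  have hT' : Measurable fun ω => T ω n := (measurable_pi_apply n).comp hT
  have hS' : Measurable fun ω => S ω n := (measurable_pi_apply n).comp hS
  exact (hT' measurableSet_Ioc).inter (hS' k.2.2.2)

end Enumeration

/-! ### Probabilities of no point and of two or more points. -/

section PoissonBounds

lemma measure_eq_zero_of_hasLaw_poissonENat {Ω : Type*} [MeasurableSpace Ω] {P : Measure Ω}
    {N : Ω → ℕ∞} {m : ℝ} (hm : 0 ≤ m) (hN : HasLaw N (poissonENat m) P) :
    P {ω | N ω = 0} = ENNReal.ofReal (Real.exp (-m)) := by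
  rw [hN.measure_eq (p := fun k => k = 0) .of_discrete, poissonENat,
    Measure.map_apply .of_discrete .of_discrete]
  have : (fun k : ℕ => (k : ℕ∞)) ⁻¹' {x | x = 0} = {0} := by ext; simp
  rw [this, poissonMeasure_singleton]
  simp [Real.coe_toNNReal m hm]

/-- From `e⁻ᵐ ≥ 1 - m` one gets `1 - e⁻ᵐ (1 + m) ≤ 1 - (1 - m)(1 + m) = m²`. The quadratic order is
what makes the union bound in `ae_injOn` vanish. -/
lemma measure_two_le_of_hasLaw_poissonENat {Ω : Type*} [MeasurableSpace Ω] {P : Measure Ω}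
    {N : Ω → ℕ∞} {m : ℝ} (hm : 0 ≤ m) (hN : HasLaw N (poissonENat m) P) :
    P {ω | 2 ≤ N ω} ≤ ENNReal.ofReal (m ^ 2) := by
  rw [hN.measure_eq (p := fun k => 2 ≤ k) .of_discrete, poissonENat,
    Measure.map_apply .of_discrete .of_discrete]
  have : (fun k : ℕ => (k : ℕ∞)) ⁻¹' {x | 2 ≤ x} = (({0, 1} : Finset ℕ) : Set ℕ)ᶜ := by
    ext k
    simp
    lia
  rw [this, ← ofReal_measureReal, probReal_compl_eq_one_sub .of_discrete,
    ← sum_measureReal_singleton]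
  refine ENNReal.ofReal_le_ofReal ?_
  rw [Finset.sum_pair zero_ne_one, poissonMeasure_real_singleton, poissonMeasure_real_singleton,
    Real.coe_toNNReal m hm]
  have := Real.add_one_le_exp (-m)
  simp
  nlinarith

end PoissonBounds

/-! ### Projection of a strip to the line and enumeration of its points. -/

namespace IsPoissonPointProcess

variable {Ω E : Type*} [MeasurableSpace Ω] [MeasureSpace E] {Φ : Ω → Set E} {c κ : ℝ}
  {P : Measure Ω} {Z : Set E} {τ : E → ℝ}

lemma hasLaw_count_strip (hΦ : IsPoissonPointProcess Φ c P) (hκ : 0 ≤ κ)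
    (hZ : MeasurableSet Z) (hτ : Measurable τ)
    (hvol : ∀ B, MeasurableSet B → volume (Z ∩ τ ⁻¹' B) = ENNReal.ofReal κ * volume B)
    {B : Set ℝ} (hB : MeasurableSet B) (hB' : volume B ≠ ⊤) :
    HasLaw (fun ω => (Φ ω ∩ (Z ∩ τ ⁻¹' B)).encard)
      (poissonENat (c * κ * (volume B).toReal)) P := by
  have h := hΦ.hasLaw_count (Z ∩ τ ⁻¹' B) (hZ.inter (hτ hB))
    (by rw [hvol B hB]; exact ENNReal.mul_ne_top ENNReal.ofReal_ne_top hB')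
  rwa [hvol B hB, ENNReal.toReal_mul, ENNReal.toReal_ofReal hκ, ← mul_assoc] at h

lemma hasLaw_count_strip_Ioc (hΦ : IsPoissonPointProcess Φ c P) (hκ : 0 ≤ κ)
    (hZ : MeasurableSet Z) (hτ : Measurable τ)
    (hvol : ∀ B, MeasurableSet B → volume (Z ∩ τ ⁻¹' B) = ENNReal.ofReal κ * volume B)
    {a b : ℝ} (hab : a ≤ b) :
    HasLaw (fun ω => (Φ ω ∩ (Z ∩ τ ⁻¹' Set.Ioc a b)).encard)
      (poissonENat (c * κ * (b - a))) P := by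
  have h := hΦ.hasLaw_count_strip hκ hZ hτ hvol (measurableSet_Ioc (a := a) (b := b)) (by simp)
  rwa [Real.volume_Ioc, ENNReal.toReal_ofReal (by linarith)] at h

/-- Almost surely no two points have the same projection. -/
lemma ae_injOn (hΦ : IsPoissonPointProcess Φ c P) (hc : 0 ≤ c) (hκ : 0 ≤ κ)
    (hZ : MeasurableSet Z) (hτ : Measurable τ)
    (hvol : ∀ B, MeasurableSet B → volume (Z ∩ τ ⁻¹' B) = ENNReal.ofReal κ * volume B) :
    ∀ᵐ ω ∂P, Set.InjOn τ (Φ ω ∩ Z) := by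
  have key : ∀ M : ℕ, ∀ᵐ ω ∂P, Set.InjOn τ (Φ ω ∩ (Z ∩ τ ⁻¹' Set.Ioc (-M : ℝ) M)) := by
    intro M
    rw [ae_iff]
    let C : ℝ := c * κ * (2 * M)
    -- Two points with the same projection share one of `n + 1` cells of length `δ = 2M / (n + 1)`.
    -- The union bound is `(n + 1) (c κ δ)² = C² / (n + 1)`, which tends to `0`.
    have hbound : ∀ n : ℕ, P {ω | ¬ Set.InjOn τ (Φ ω ∩ (Z ∩ τ ⁻¹' Set.Ioc (-M : ℝ) M))} ≤
        ENNReal.ofReal (C ^ 2 / (n + 1)) := by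
      intro n
      let δ : ℝ := 2 * M / (n + 1)
      have hδ : 0 ≤ δ := by positivity
      let I : ℕ → Set ℝ := fun k => Set.Ioc (-M + k * δ) (-M + (k + 1) * δ)
      have hsub : {ω | ¬ Set.InjOn τ (Φ ω ∩ (Z ∩ τ ⁻¹' Set.Ioc (-M : ℝ) M))} ⊆
          ⋃ k ∈ Finset.range (n + 1), {ω | 2 ≤ (Φ ω ∩ (Z ∩ τ ⁻¹' I k)).encard} := by
        intro ω hω
        simp only [Set.mem_ofPred_eq, Set.InjOn, not_forall] at hω
        obtain ⟨x, ⟨hx, hxZ, hxI⟩, y, ⟨hy, hyZ, hyI⟩, hxy, hne⟩ := hω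
        have hxI' : -(M : ℝ) < τ x ∧ τ x ≤ M := hxI
        have hMpos : 0 < (M : ℝ) := by linarith [hxI'.1, hxI'.2]
        have hδ' : 0 < δ := by positivity
        let s : ℝ := (τ x + M) / δ
        have hs : 0 < s := div_pos (by linarith [hxI'.1]) hδ'
        have hsn : s ≤ n + 1 := by
          rw [div_le_iff₀ hδ']
          have : ((n : ℝ) + 1) * δ = 2 * M := by simp only [δ]; field_simp
          linarith [hxI'.2]
        have hsδ : s * δ = τ x + M := div_mul_cancel₀ _ hδ'.ne'
        -- The cells are open on the left, so the cell index is the ceiling minus one.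
        obtain ⟨k, hk⟩ : ∃ k : ℕ, ⌈s⌉₊ = k + 1 :=
          ⟨⌈s⌉₊ - 1, by have := Nat.ceil_pos.2 hs; lia⟩
        have hk1 : s ≤ k + 1 := by
          have := Nat.le_ceil s
          rw [hk] at this
          exact_mod_cast this
        have hk2 : (k : ℝ) < s := Nat.lt_ceil.1 (by lia)
        have hkn : k < n + 1 := by exact_mod_cast hk2.trans_le hsn
        have hxk : τ x ∈ I k := by
          constructor <;> nlinarith
        refine Set.mem_biUnion (x := k) (by simpa using hkn) ?_
        have : ({x, y} : Set E) ⊆ Φ ω ∩ (Z ∩ τ ⁻¹' I k) := by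
          rintro w (rfl | rfl)
          · exact ⟨hx, hxZ, hxk⟩
          · exact ⟨hy, hyZ, by rw [Set.mem_preimage, ← hxy]; exact hxk⟩
        have h2 := Set.encard_le_encard this
        rwa [Set.encard_pair hne] at h2
      refine (measure_mono hsub).trans ((measure_biUnion_finset_le _ _).trans ?_)
      have hk : ∀ k ∈ Finset.range (n + 1), P {ω | 2 ≤ (Φ ω ∩ (Z ∩ τ ⁻¹' I k)).encard} ≤
          ENNReal.ofReal ((c * κ * δ) ^ 2) := by
        intro k _
        have h := hΦ.hasLaw_count_strip_Ioc hκ hZ hτ hvol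
          (a := -M + k * δ) (b := -M + (k + 1) * δ) (by nlinarith)
        have e : c * κ * (-M + (k + 1) * δ - (-M + k * δ)) = c * κ * δ := by ring
        rw [e] at h
        exact measure_two_le_of_hasLaw_poissonENat (by positivity) h
      refine (Finset.sum_le_sum hk).trans ?_
      rw [Finset.sum_const, Finset.card_range, nsmul_eq_mul, ← ENNReal.ofReal_natCast,
        ← ENNReal.ofReal_mul (by positivity)]
      refine ENNReal.ofReal_le_ofReal (le_of_eq ?_)
      simp only [C, δ]
      push_cast
      field_simp
    have hlim : Filter.Tendsto (fun n : ℕ => ENNReal.ofReal (C ^ 2 / (n + 1))) Filter.atTop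
        (nhds 0) := by
      rw [← ENNReal.ofReal_zero]
      exact ENNReal.tendsto_ofReal (tendsto_const_div_atTop_nhds_zero_nat (C ^ 2) |>.comp
        (Filter.tendsto_add_atTop_nat 1) |>.congr fun n => by simp)
    exact le_antisymm (ge_of_tendsto' hlim hbound) zero_le
  filter_upwards [ae_all_iff.2 key] with ω hω x hx y hy hxy
  obtain ⟨M, hM⟩ := exists_nat_gt |τ x|
  obtain ⟨h1, h2⟩ := abs_lt.1 hM
  exact hω M ⟨hx.1, hx.2, h1, h2.le⟩ ⟨hy.1, hy.2, by
    rw [Set.mem_preimage, ← hxy]; exact ⟨h1, h2.le⟩⟩ hxy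

/-- An interval of length `n` inside `U` is empty of projections with probability `exp (-c κ n)`,
and `n` is arbitrary. -/
lemma ae_exists_mem_of_forall_Ioc (hΦ : IsPoissonPointProcess Φ c P) (hc : 0 < c) (hκ : 0 < κ)
    (hZ : MeasurableSet Z) (hτ : Measurable τ)
    (hvol : ∀ B, MeasurableSet B → volume (Z ∩ τ ⁻¹' B) = ENNReal.ofReal κ * volume B)
    {U : Set ℝ} (hU : ∀ n : ℕ, ∃ a : ℝ, Set.Ioc a (a + n) ⊆ U) :
    ∀ᵐ ω ∂P, ∃ y ∈ τ '' (Φ ω ∩ Z), y ∈ U := by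
  rw [ae_iff]
  have hbound : ∀ n : ℕ, P {ω | ¬ ∃ y ∈ τ '' (Φ ω ∩ Z), y ∈ U} ≤
      ENNReal.ofReal (Real.exp (-(c * κ * n))) := by
    intro n
    obtain ⟨a, ha⟩ := hU n
    have h := hΦ.hasLaw_count_strip_Ioc hκ.le hZ hτ hvol (a := a) (b := a + n) (by simp)
    rw [add_sub_cancel_left] at h
    rw [← measure_eq_zero_of_hasLaw_poissonENat (by positivity) h]
    refine measure_mono fun ω hω => ?_
    simp only [Set.mem_ofPred_eq, Set.encard_eq_zero]
    refine Set.eq_empty_iff_forall_notMem.2 fun x hx => hω ?_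
    exact ⟨τ x, ⟨x, ⟨hx.1, hx.2.1⟩, rfl⟩, ha hx.2.2⟩
  have hlim : Filter.Tendsto (fun n : ℕ => ENNReal.ofReal (Real.exp (-(c * κ * n))))
      Filter.atTop (nhds 0) := by
    rw [← ENNReal.ofReal_zero]
    refine ENNReal.tendsto_ofReal (Real.tendsto_exp_neg_atTop_nhds_zero.comp ?_)
    exact tendsto_natCast_atTop_atTop.const_mul_atTop (by positivity)
  exact le_antisymm (ge_of_tendsto' hlim hbound) zero_le

/-- Almost surely, the points in a strip can be enumerated by the integers in the order of their
projections. -/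
lemma ae_exists_enumeration (hΦ : IsPoissonPointProcess Φ c P) (hc : 0 < c) (hκ : 0 < κ)
    (hZ : MeasurableSet Z) (hτ : Measurable τ)
    (hvol : ∀ B, MeasurableSet B → volume (Z ∩ τ ⁻¹' B) = ENNReal.ofReal κ * volume B) :
    ∀ᵐ ω ∂P, ∃ X : ℤ → E, (StrictMono (τ ∘ X) ∧ τ (X 0) ≤ 0 ∧ 0 < τ (X 1)) ∧
      Set.range X = Φ ω ∩ Z := by
  have hup : ∀ᵐ ω ∂P, ∀ m : ℕ, ∃ y ∈ τ '' (Φ ω ∩ Z), y ∈ Set.Ioi (m : ℝ) :=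
    ae_all_iff.2 fun m => hΦ.ae_exists_mem_of_forall_Ioc hc hκ hZ hτ hvol
      fun n => ⟨m, fun x hx => hx.1⟩
  have hdown : ∀ᵐ ω ∂P, ∀ m : ℕ, ∃ y ∈ τ '' (Φ ω ∩ Z), y ∈ Set.Iic (-m : ℝ) :=
    ae_all_iff.2 fun m => hΦ.ae_exists_mem_of_forall_Ioc hc hκ hZ hτ hvol
      fun n => ⟨-m - n, fun x hx => by simpa using hx.2⟩
  have hfin : ∀ᵐ ω ∂P, ∀ m : ℕ, (Φ ω ∩ (Z ∩ τ ⁻¹' Set.Ioc (-m : ℝ) m)).Finite := by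
    refine ae_all_iff.2 fun m => hΦ.ae_finite (hZ.inter (hτ measurableSet_Ioc)) ?_
    rw [hvol _ measurableSet_Ioc]
    exact ENNReal.mul_ne_top ENNReal.ofReal_ne_top (by simp)
  filter_upwards [hup, hdown, hfin, hΦ.ae_injOn hc.le hκ.le hZ hτ hvol] with ω h1 h2 h3 h4
  obtain ⟨T, hT, hTr⟩ := exists_strictMono_int_enumeration (A := τ '' (Φ ω ∩ Z))
    (by
      intro a b
      obtain ⟨m, hm⟩ := exists_nat_gt (max (-a) b)
      refine ((h3 m).image τ).subset ?_
      rintro _ ⟨⟨x, hx, rfl⟩, ha, hb⟩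
      have := lt_of_le_of_lt (le_max_left _ _) hm
      have := lt_of_le_of_lt (le_max_right _ _) hm
      exact ⟨x, ⟨hx.1, hx.2, by linarith, by linarith⟩, rfl⟩)
    (fun x => by
      obtain ⟨m, hm⟩ := exists_nat_gt x
      obtain ⟨y, hy, hy'⟩ := h1 m
      exact ⟨y, hy, hm.trans hy'⟩)
    (fun x => by
      obtain ⟨m, hm⟩ := exists_nat_gt (-x)
      obtain ⟨y, hy, hy'⟩ := h2 m
      exact ⟨y, hy, by have : y ≤ -m := hy'; linarith⟩)
  have hex : ∀ n, ∃ x ∈ Φ ω ∩ Z, τ x = T n := fun n => by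
    have : T n ∈ τ '' (Φ ω ∩ Z) := hTr ▸ Set.mem_range_self n
    exact this
  choose X hX hX' using hex
  obtain rfl : τ ∘ X = T := funext hX'
  refine ⟨X, hT, Set.Subset.antisymm (by rintro _ ⟨n, rfl⟩; exact hX n) fun x hx => ?_⟩
  obtain ⟨n, hn⟩ : τ x ∈ Set.range (τ ∘ X) := hTr ▸ Set.mem_image_of_mem τ hx
  exact ⟨n, h4 (hX n) hx hn⟩

end IsPoissonPointProcess

/-! ### Marking: a product intensity gives independent i.i.d. marks. -/

section Marking

/-- The character `exp (i ∑ θ j 1_{B j})` of a finite family of sets. -/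
noncomputable def setPhase {E ι : Type*} [Fintype ι] (B : ι → Set E) (θ : ι → ℝ) (x : E) : ℂ :=
  Complex.exp ((∑ j, θ j * (B j).indicator (1 : E → ℝ) x : ℝ) * Complex.I)

lemma norm_setPhase {E ι : Type*} [Fintype ι] (B : ι → Set E) (θ : ι → ℝ) (x : E) :
    ‖setPhase B θ x‖ = 1 := Complex.norm_exp_ofReal_mul_I _

lemma setPhase_eq_one {E ι : Type*} [Fintype ι] {B : ι → Set E} (θ : ι → ℝ) {x : E}
    (hx : ∀ j, x ∉ B j) : setPhase B θ x = 1 := by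
  simp [setPhase, hx]

lemma measurable_setPhase {E ι : Type*} [MeasurableSpace E] [Fintype ι]
    {B : ι → Set E} (hB : ∀ j, MeasurableSet (B j)) (θ : ι → ℝ) : Measurable (setPhase B θ) :=
  measurable_exp_sum_indicator hB θ

lemma integral_infinitePi_prod {ι : Type*} (ν : Measure ℝ) [IsProbabilityMeasure ν]
    (A : Finset ι) {g : ι → ℝ → ℂ} (hg : ∀ n, Measurable (g n)) :
    ∫ s, ∏ n ∈ A, g n (s n) ∂(Measure.infinitePi fun _ : ι => ν) =
      ∏ n ∈ A, ∫ x, g n x ∂ν := by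
  have h := (iIndepFun_infinitePi (P := fun _ : ι => ν) (X := fun _ => id)
    (fun _ => measurable_id)).precomp (g := ((↑) : A → ι)) Subtype.val_injective
  have h2 := h.integral_fun_prod_comp (f := fun n : A => g n)
    (fun n => (measurable_pi_apply (n : ι)).aemeasurable) (fun n => (hg n).aestronglyMeasurable)
  simp only [id] at h2
  rw [← Finset.prod_coe_sort A (fun n => ∫ x, g n x ∂ν)]
  simp_rw [← Finset.prod_coe_sort A]
  rw [h2]
  refine Finset.prod_congr rfl fun n _ => ?_
  have e := measurePreserving_eval_infinitePi (fun _ : ι => ν) (n : ι)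
  exact (integral_map (f := g n) e.measurable.aemeasurable (hg n).aestronglyMeasurable).symm.trans
    (by rw [e.map_eq])

/-- The joint characteristic function of the box counts of a Poisson process on the line with
independent marks. -/
lemma integral_exp_boxCount_prod {Ω : Type*} [MeasurableSpace Ω] {P : Measure Ω}
    [IsProbabilityMeasure P] {T : Ω → ℤ → ℝ} (hTm : Measurable T)
    (hT : ∀ ω, StrictMono (T ω)) {α : ℝ} (hα : 0 ≤ α)
    (hP : IsPoissonPointProcess (fun ω => Set.range (T ω)) α P)
    (ν : Measure ℝ) [IsProbabilityMeasure ν] {ι : Type*} [Fintype ι] (k : ι → BoxKey)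
    (θ : ι → ℝ) :
    ∫ q : Ω × (ℤ → ℝ), Complex.exp ((∑ j, θ j * ((boxCount (T q.1) q.2 (k j)).toNat : ℝ) : ℝ) *
        Complex.I) ∂(P.prod (Measure.infinitePi fun _ => ν)) =
      Complex.exp (α * ∫ t, ∫ s, (setPhase (fun j => (k j).box) θ (t, s) - 1) ∂ν) := by
  classical
  let F := setPhase (fun j => (k j).box) θ
  have hF : Measurable F := measurable_setPhase (fun j => (k j).measurableSet_box) θ
  have hFt : ∀ t, Measurable fun s => F (t, s) := fun t => hF.comp measurable_prodMk_left
  have hFi : ∀ t, Integrable (fun s => F (t, s)) ν := fun t =>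
    .of_bound (hFt t).aestronglyMeasurable 1 (.of_forall fun s => (norm_setPhase _ _ _).le)
  -- Given the arrivals, independence of the marks averages the character to the product of `h` over
  -- the points, so the generating functional of the arrivals applies to `h`.
  let h : ℝ → ℂ := fun t => ∫ s, F (t, s) ∂ν
  have hh : Measurable h := (hF.stronglyMeasurable.integral_prod_right' (ν := ν)).measurable
  have hhr : (Set.range h).Finite := by
    -- `h t` depends on `t` only through which base intervals contain it.
    refine (Set.finite_range fun p : ι → Bool => ∫ s, Complex.exp ((∑ j, θ j *
      (if p j ∧ s ∈ (k j).2.2.1 then 1 else 0) : ℝ) * Complex.I) ∂ν).subset ?_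
    rintro _ ⟨t, rfl⟩
    refine ⟨fun j => decide (t ∈ Set.Ioc (k j).1 (k j).2.1), ?_⟩
    simp [h, F, setPhase, Set.indicator_apply, BoxKey.box]
  let W : Set ℝ := ⋃ j, Set.Ioc (k j).1 (k j).2.1
  have hW : MeasurableSet W := .iUnion fun j => measurableSet_Ioc
  have hW' : volume W ≠ ⊤ := by
    refine ne_top_of_le_ne_top ?_ (measure_iUnion_fintype_le volume _)
    exact ENNReal.sum_ne_top.2 fun j _ => by simp
  have hone : ∀ t ∉ W, ∀ s, F (t, s) = 1 := fun t ht s =>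
    setPhase_eq_one θ fun j hj => ht (Set.mem_iUnion.2 ⟨j, hj.1⟩)
  have hmeas : Measurable fun q : Ω × (ℤ → ℝ) =>
      Complex.exp ((∑ j, θ j * ((boxCount (T q.1) q.2 (k j)).toNat : ℝ) : ℝ) * Complex.I) := by
    have h1 : Measurable fun q : Ω × (ℤ → ℝ) => boxCount (T q.1) q.2 :=
      measurable_boxCount (hTm.comp measurable_fst) measurable_snd
    have h2 : ∀ j, Measurable fun q : Ω × (ℤ → ℝ) =>
        ((boxCount (T q.1) q.2 (k j)).toNat : ℝ) := fun j =>
      (Measurable.of_discrete (f := fun n : ℕ∞ => (n.toNat : ℝ))).comp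
        ((measurable_pi_apply (k j)).comp h1)
    fun_prop
  rw [integral_prod]
  · have hinner : ∀ᵐ ω ∂P, ∫ s : ℤ → ℝ, Complex.exp ((∑ j, θ j *
        ((boxCount (T ω) s (k j)).toNat : ℝ) : ℝ) * Complex.I) ∂(Measure.infinitePi fun _ => ν) =
          ∏ᶠ t ∈ Set.range (T ω) ∩ W, h t := by
      filter_upwards [hP.ae_finite hW hW'] with ω hω
      have hAim : Set.range (T ω) ∩ W = T ω '' (T ω ⁻¹' W) := by
        rw [Set.image_preimage_eq_range_inter]
      have hA : (T ω ⁻¹' W).Finite :=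
        Set.Finite.of_finite_image (hAim ▸ hω) (hT ω).injective.injOn
      rw [hAim, finprod_mem_image (hT ω).injective.injOn,
        finprod_mem_eq_finite_toFinset_prod _ hA,
        ← integral_infinitePi_prod ν _ (g := fun n s => F (T ω n, s)) (fun n => hFt _)]
      refine integral_congr_ae (.of_forall fun s => ?_)
      have := exp_sum_encard_eq_finprod hA (B := fun j => {n | (T ω n, s n) ∈ (k j).box})
        (fun j n hn => Set.mem_iUnion.2 ⟨j, hn.1⟩) θ
      rw [finprod_mem_eq_finite_toFinset_prod _ hA] at this
      exact this
    rw [integral_congr_ae hinner, hP.integral_finprod hα hW hW' hh hhr]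
    congr 2
    rw [setIntegral_eq_integral_of_forall_compl_eq_zero]
    · refine integral_congr_ae (.of_forall fun t => ?_)
      simp only [h]
      rw [integral_sub (hFi t) (integrable_const _)]
      simp
    · intro t ht
      simp [h, hone t ht]
  · exact .of_bound hmeas.aestronglyMeasurable 1
      (.of_forall fun q => (Complex.norm_exp_ofReal_mul_I _).le)

/-- The joint characteristic function of the counts of a Poisson process in preimages of
boxes, when the intensity is mapped to a product. -/
lemma IsPoissonPointProcess.integral_exp_box {Ω E : Type*} [MeasurableSpace Ω] [MeasureSpace E]
    {Φ : Ω → Set E} {c κ : ℝ} {P : Measure Ω} (hΦ : IsPoissonPointProcess Φ c P) (hc : 0 ≤ c)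
    (hκ : 0 ≤ κ) {Z : Set E} (hZ : MeasurableSet Z) {τ σ : E → ℝ} (hτ : Measurable τ)
    (hσ : Measurable σ) (ν : Measure ℝ) [IsProbabilityMeasure ν]
    (hmap : (volume.restrict Z).map (fun x => (τ x, σ x)) =
      (ENNReal.ofReal κ • (volume : Measure ℝ)).prod ν)
    {ι : Type*} [Fintype ι] (k : ι → BoxKey) (θ : ι → ℝ) :
    ∫ ω, Complex.exp ((∑ j, θ j * ((Φ ω ∩ (Z ∩ (fun x => (τ x, σ x)) ⁻¹' (k j).box)).encard.toNat
        : ℝ) : ℝ) * Complex.I) ∂P =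
      Complex.exp ((c * κ : ℝ) * ∫ t, ∫ s, (setPhase (fun j => (k j).box) θ (t, s) - 1) ∂ν) := by
  have hg : Measurable fun x => (τ x, σ x) := hτ.prodMk hσ
  let F := setPhase (fun j => (k j).box) θ
  have hF : Measurable F := measurable_setPhase (fun j => (k j).measurableSet_box) θ
  have hvol : ∀ j, (ENNReal.ofReal κ • (volume : Measure ℝ)).prod ν (k j).box ≠ ⊤ := by
    intro j
    rw [BoxKey.box, Measure.prod_prod]
    refine ENNReal.mul_ne_top ?_ (measure_ne_top _ _)
    simp [ENNReal.mul_eq_top]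
  have hB : ∀ j, MeasurableSet (Z ∩ (fun x => (τ x, σ x)) ⁻¹' (k j).box) := fun j =>
    hZ.inter (hg (k j).measurableSet_box)
  have hB' : ∀ j, volume (Z ∩ (fun x => (τ x, σ x)) ⁻¹' (k j).box) ≠ ⊤ := fun j => by
    have := hvol j
    rwa [← hmap, Measure.map_apply hg (k j).measurableSet_box,
      Measure.restrict_apply (hg (k j).measurableSet_box), Set.inter_comm] at this
  rw [hΦ.integral_exp_count hc hB hB' θ]
  congr 1
  rw [Complex.ofReal_mul, mul_assoc]
  congr 1
  have e1 : ∫ x, (setPhase (fun j => Z ∩ (fun x => (τ x, σ x)) ⁻¹' (k j).box) θ x - 1) =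
      ∫ x in Z, (F (τ x, σ x) - 1) := by
    rw [← setIntegral_eq_integral_of_forall_compl_eq_zero (s := Z)]
    · refine setIntegral_congr_fun hZ fun x hx => ?_
      have hj : ∀ j, (Z ∩ (fun x => (τ x, σ x)) ⁻¹' (k j).box).indicator (1 : E → ℝ) x =
          (k j).box.indicator (1 : ℝ × ℝ → ℝ) (τ x, σ x) := fun j => by
        by_cases h : (τ x, σ x) ∈ (k j).box
        · rw [Set.indicator_of_mem h, Set.indicator_of_mem (show x ∈ Z ∩ _ from ⟨hx, h⟩)]
          rfl
        · rw [Set.indicator_of_notMem h, Set.indicator_of_notMem fun h' => h h'.2]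
      simp only [F, setPhase, hj]
    · intro x hx
      rw [setPhase_eq_one θ fun j hj => hx hj.1, sub_self]
  have e2 : ∫ x in Z, (F (τ x, σ x) - 1) =
      ∫ p, (F p - 1) ∂((ENNReal.ofReal κ • (volume : Measure ℝ)).prod ν) := by
    rw [← hmap, integral_map hg.aemeasurable (hF.sub_const 1).aestronglyMeasurable]
  change ∫ x, (setPhase (fun j => Z ∩ (fun x => (τ x, σ x)) ⁻¹' (k j).box) θ x - 1) = _
  rw [e1, e2, integral_prod, integral_smul_measure, ENNReal.toReal_ofReal hκ, Complex.real_smul]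
  -- Fubini is justified because `F - 1` is bounded by `2` and vanishes off boxes of finite total
  -- measure.
  let W : Set (ℝ × ℝ) := ⋃ j, (k j).box
  have hW : MeasurableSet W := .iUnion fun j => (k j).measurableSet_box
  have hW' : (ENNReal.ofReal κ • (volume : Measure ℝ)).prod ν W ≠ ⊤ := by
    refine ne_top_of_le_ne_top ?_ (measure_iUnion_fintype_le _ _)
    exact ENNReal.sum_ne_top.2 fun j _ => hvol j
  rw [← integrableOn_iff_integrable_of_support_subset (s := W)]
  · refine .of_bound hW'.lt_top (hF.sub_const 1).aestronglyMeasurable 2 (.of_forall fun p => ?_)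
    refine (norm_sub_le _ _).trans ?_
    rw [norm_setPhase]
    norm_num
  · intro p hp
    by_contra h
    refine hp ?_
    simp only [F]
    rw [setPhase_eq_one θ fun j hj => h (Set.mem_iUnion.2 ⟨j, hj⟩), sub_self]

/-- If the points in a strip are mapped to the half-plane of arrival times and marks in such a way
that the intensity becomes a product, then they are the customers of a stationary `M/GI/∞`
queue. -/
theorem IsPoissonPointProcess.exists_isStationaryMGIInfinityQueue {Ω E : Type*}
    [MeasurableSpace Ω] [MeasureSpace E] [Nonempty E]
    {Φ : Ω → Set E} {c κ : ℝ} {P : Measure Ω} [IsProbabilityMeasure P]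
    (hΦ : IsPoissonPointProcess Φ c P) (hc : 0 < c)
    (hκ : 0 < κ) {Z : Set E} (hZ : MeasurableSet Z) {τ σ : E → ℝ} (hτ : Measurable τ)
    (hσ : Measurable σ) (ν : Measure ℝ) [IsProbabilityMeasure ν]
    (hmap : (volume.restrict Z).map (fun x => (τ x, σ x)) =
      (ENNReal.ofReal κ • (volume : Measure ℝ)).prod ν) :
    ∃ (T S : ℤ → Ω → ℝ) (X : ℤ → Ω → E), IsStationaryMGIInfinityQueue T S (c * κ) ν P ∧
      ∀ᵐ ω ∂P, Function.Injective (fun n => X n ω) ∧ Set.range (fun n => X n ω) = Φ ω ∩ Z ∧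
        ∀ n, T n ω = τ (X n ω) ∧ S n ω = σ (X n ω) := by
  classical
  have hg : Measurable fun x => (τ x, σ x) := hτ.prodMk hσ
  have hvol : ∀ B, MeasurableSet B → volume (Z ∩ τ ⁻¹' B) = ENNReal.ofReal κ * volume B := by
    intro B hB
    have := congrArg (fun m => m (B ×ˢ Set.univ)) hmap
    simp only [Measure.prod_prod, measure_univ, mul_one] at this
    rw [Measure.map_apply hg (hB.prod .univ), Measure.restrict_apply (hg (hB.prod .univ))] at this
    rw [Set.inter_comm]
    simpa [Set.mk_preimage_prod] using this
  have hae := hΦ.ae_exists_enumeration hc hκ hZ hτ hvol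
  -- The set where no enumeration exists need not be measurable; it is enclosed in a measurable null
  -- set.
  obtain ⟨N₀, hN₀, hN₀m, hN₀P⟩ := exists_measurable_superset_of_null (ae_iff.1 hae)
  have hgood : ∀ ω, ω ∉ N₀ → ∃ X : ℤ → E, (StrictMono (τ ∘ X) ∧ τ (X 0) ≤ 0 ∧ 0 < τ (X 1)) ∧
      Set.range X = Φ ω ∩ Z := fun ω hω => by
    by_contra h
    exact hω (hN₀ h)
  choose! X hX hXr using hgood
  have hGae : ∀ᵐ ω ∂P, ω ∉ N₀ := measure_eq_zero_iff_ae_notMem.1 hN₀P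
  -- On `N₀` the arrivals are placed at the integers, so that the ordering holds for every `ω`, as
  -- `exists_measurableSet_boxCount` requires.
  let T : Ω → ℤ → ℝ := fun ω n => if ω ∈ N₀ then n else τ (X ω n)
  let S : Ω → ℤ → ℝ := fun ω n => if ω ∈ N₀ then 0 else σ (X ω n)
  have hord : ∀ ω, StrictMono (T ω) ∧ T ω 0 ≤ 0 ∧ 0 < T ω 1 := by
    intro ω
    by_cases hω : ω ∈ N₀
    · simp only [T, hω, if_true]
      exact ⟨fun m n h => by simpa using h, by simp, by simp⟩
    · simp only [T, hω, if_false]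
      exact hX ω hω
  have hencard : ∀ ω, ω ∉ N₀ → ∀ B : Set (ℝ × ℝ), {n | (T ω n, S ω n) ∈ B}.encard =
      (Φ ω ∩ (Z ∩ (fun x => (τ x, σ x)) ⁻¹' B)).encard := by
    intro ω hω B
    have hinj : Function.Injective (X ω) := (hX ω hω).1.injective.of_comp
    rw [← Set.inter_assoc, ← hXr ω hω, ← hinj.encard_image]
    congr 1
    ext x
    simp only [T, S, hω, if_false, Set.mem_image, Set.mem_ofPred_eq, Set.mem_inter_iff,
      Set.mem_range, Set.mem_preimage]
    constructor
    · rintro ⟨n, hn, rfl⟩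
      exact ⟨⟨n, rfl⟩, hn⟩
    · rintro ⟨⟨n, rfl⟩, hn⟩
      exact ⟨n, hn, rfl⟩
  have hcount : ∀ B : Set (ℝ × ℝ), MeasurableSet B →
      Measurable fun ω => {n | (T ω n, S ω n) ∈ B}.encard := by
    intro B hB
    have e : (fun ω => {n | (T ω n, S ω n) ∈ B}.encard) = fun ω => if ω ∈ N₀ then
        {n : ℤ | ((n : ℝ), (0 : ℝ)) ∈ B}.encard else
          (Φ ω ∩ (Z ∩ (fun x => (τ x, σ x)) ⁻¹' B)).encard := by
      funext ω
      by_cases hω : ω ∈ N₀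
      · simp [T, S, hω]
      · simp only [hω, if_false]
        exact hencard ω hω B
    rw [e]
    exact Measurable.ite hN₀m measurable_const (hΦ.measurable_count _ (hZ.inter (hg hB)))
  have hbox : Measurable fun ω => boxCount (T ω) (S ω) :=
    measurable_pi_lambda _ fun k => hcount _ k.measurableSet_box
  -- `X` was picked by choice, with no measurability in `ω`. Measurability of `(T, S)` is recovered
  -- from the box counts, which off `N₀` are counts of `Φ`.
  have hTS : Measurable fun ω => (T ω, S ω) := by
    intro A hA
    obtain ⟨D, hD, hD'⟩ := exists_measurableSet_boxCount hA
    convert hbox hD using 1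
    ext ω
    exact hD' _ _ (hord ω)
  have hTm : Measurable T := measurable_fst.comp hTS
  have hSm : Measurable S := measurable_snd.comp hTS
  have hrange : ∀ (B : Set ℝ) (ω : Ω), (Set.range (T ω) ∩ B).encard =
      {n | (T ω n, S ω n) ∈ B ×ˢ (Set.univ : Set ℝ)}.encard := by
    intro B ω
    rw [← (hord ω).1.injective.encard_image]
    congr 1
    ext t
    simp only [Set.mem_inter_iff, Set.mem_range, Set.mem_image, Set.mem_ofPred_eq, Set.mem_prod,
      Set.mem_univ, and_true]
    constructor
    · rintro ⟨⟨n, rfl⟩, hn⟩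
      exact ⟨n, hn, rfl⟩
    · rintro ⟨n, hn, rfl⟩
      exact ⟨⟨n, rfl⟩, hn⟩
  have hrange' : ∀ (B : Set ℝ) (ω : Ω), ω ∉ N₀ → (Set.range (T ω) ∩ B).encard =
      (Φ ω ∩ (Z ∩ τ ⁻¹' B)).encard := by
    intro B ω hω
    rw [hrange, hencard ω hω, Set.mk_preimage_prod]
    simp
  have hpoisson : IsPoissonPointProcess (fun ω => Set.range (T ω)) (c * κ) P := by
    refine ⟨fun B hB => ?_, fun B hB hB' => ?_, fun n B hB hB' hd => ?_⟩
    · simp_rw [hrange]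
      exact hcount _ (hB.prod .univ)
    · refine (hΦ.hasLaw_count_strip hκ.le hZ hτ hvol hB hB').congr ?_
      filter_upwards [hGae] with ω hω using hrange' B ω hω
    · have h := hΦ.indep_count n (fun i => Z ∩ τ ⁻¹' (B i)) (fun i => hZ.inter (hτ (hB i)))
        (fun i => by
          rw [hvol _ (hB i)]
          exact ENNReal.mul_ne_top ENNReal.ofReal_ne_top (hB' i))
        (fun i j hij => ((hd hij).preimage τ).mono Set.inter_subset_right Set.inter_subset_right)
      refine h.congr fun i => ?_
      filter_upwards [hGae] with ω hω using (hrange' (B i) ω hω).symm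
  -- The model: the same arrivals, with fresh i.i.d. marks. Equality of the box-count laws is later
  -- lifted to equality of the laws of the sequences.
  let P' := P.prod (Measure.infinitePi fun _ : ℤ => ν)
  have hbox' : Measurable fun q : Ω × (ℤ → ℝ) => boxCount (T q.1) q.2 :=
    measurable_boxCount (hTm.comp measurable_fst) measurable_snd
  have hlawbox : P.map (fun ω => boxCount (T ω) (S ω)) =
      P'.map (fun q => boxCount (T q.1) q.2) := by
    have hfin : ∀ k : BoxKey, ∀ᵐ ω ∂P, (Set.range (T ω) ∩ Set.Ioc k.1 k.2.1).encard ≠ ⊤ := by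
      intro k
      filter_upwards [hpoisson.ae_finite (measurableSet_Ioc (a := k.1) (b := k.2.1)) (by simp)]
        with ω hω using Set.encard_ne_top_iff.2 hω
    have hle : ∀ (k : BoxKey) ω (s : ℤ → ℝ), boxCount (T ω) s k ≤
        (Set.range (T ω) ∩ Set.Ioc k.1 k.2.1).encard := by
      intro k ω s
      rw [hrange]
      exact Set.encard_le_encard fun n hn => ⟨hn.1, trivial⟩
    refine map_eq_of_integral_exp_toNat_eq hbox hbox' (fun k => ?_) (fun k => ?_) fun J θ => ?_
    · filter_upwards [hfin k] with ω hω using ne_top_of_le_ne_top hω (hle _ _ _)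
    · have := Measure.quasiMeasurePreserving_fst (μ := P)
        (ν := Measure.infinitePi fun _ : ℤ => ν) |>.ae (hfin k)
      filter_upwards [this] with q hq using ne_top_of_le_ne_top hq (hle _ _ _)
    · rw [integral_exp_boxCount_prod hTm (fun ω => (hord ω).1) (by positivity) hpoisson ν
        (fun j : J => j) θ,
        ← hΦ.integral_exp_box hc.le hκ.le hZ hτ hσ ν hmap (fun j : J => j) θ]
      refine integral_congr_ae ?_
      filter_upwards [hGae] with ω hω
      congr 5
      funext j
      rw [← hencard ω hω]
      rfl
  have hlaw : P.map (fun ω => (T ω, S ω)) =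
      (P.map T).prod (Measure.infinitePi fun _ : ℤ => ν) := by
    have e : (P.map T).prod (Measure.infinitePi fun _ : ℤ => ν) =
        P'.map (fun q => (T q.1, q.2)) := by
      conv_lhs => rw [← Measure.map_id (μ := Measure.infinitePi fun _ : ℤ => ν)]
      rw [Measure.map_prod_map _ _ hTm measurable_id]
      rfl
    rw [e]
    have hm : Measurable fun q : Ω × (ℤ → ℝ) => (T q.1, q.2) :=
      (hTm.comp measurable_fst).prodMk measurable_snd
    ext A hA
    obtain ⟨D, hD, hD'⟩ := exists_measurableSet_boxCount hA
    rw [Measure.map_apply hTS hA, Measure.map_apply hm hA]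
    have h := congrArg (fun m => m D) hlawbox
    simp only [Measure.map_apply hbox hD, Measure.map_apply hbox' hD] at h
    convert h using 2
    · ext ω
      exact hD' _ _ (hord ω)
    · ext q
      exact hD' _ _ (hord q.1)
  have : IsProbabilityMeasure (P.map T) := Measure.isProbabilityMeasure_map hTm.aemeasurable
  have hlawS : P.map S = Measure.infinitePi fun _ : ℤ => ν := by
    have := congrArg Measure.snd hlaw
    rwa [Measure.snd_prod, Measure.snd_map_prodMk hTm] at this
  have hSn : ∀ n, Measurable fun ω => S ω n := fun n => (measurable_pi_apply n).comp hSm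
  have hlawSn : ∀ n, HasLaw (fun ω => S ω n) ν P := by
    intro n
    refine ⟨(hSn n).aemeasurable, ?_⟩
    have e := measurePreserving_eval_infinitePi (fun _ : ℤ => ν) n
    rw [← e.map_eq, ← hlawS, Measure.map_map e.measurable hSm]
    rfl
  refine ⟨fun n ω => T ω n, fun n ω => S ω n, fun n ω => X ω n, ⟨fun n =>
    (measurable_pi_apply n).comp hTm, hSn, .of_forall hord, hpoisson, hlawSn, ?_, ?_⟩, ?_⟩
  · rw [iIndepFun_iff_map_fun_eq_infinitePi_map hSn]
    simp_rw [fun n => (hlawSn n).map_eq]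
    exact hlawS
  · rw [indepFun_iff_map_prod_eq_prod_map_map hTm.aemeasurable hSm.aemeasurable]
    rw [hlawS, hlaw]
  · filter_upwards [hGae] with ω hω
    refine ⟨(hX ω hω).1.injective.of_comp, hXr ω hω, fun n => ?_⟩
    simp [T, S, hω]

end Marking

/-! ### The service law as the law of a random chord time. -/

section ServiceTime

/-- The time spent in a disc of radius `r`, at speed `v`, along a chord at distance `|y|` of its
centre. -/
noncomputable def chordTime (v r y : ℝ) : ℝ := 2 * √(r ^ 2 - y ^ 2) / v

lemma measurable_chordTime (v r : ℝ) : Measurable (chordTime v r) := by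
  unfold chordTime
  fun_prop

lemma image_chordTime {v r : ℝ} (hv : 0 < v) (hr : 0 < r) :
    chordTime v r '' Set.Ioo 0 r = Set.Ioo 0 (2 * r / v) := by
  ext s
  constructor
  · rintro ⟨y, ⟨hy0, hyr⟩, rfl⟩
    have h : 0 < r ^ 2 - y ^ 2 := by nlinarith
    refine ⟨by unfold chordTime; positivity, ?_⟩
    unfold chordTime
    have : √(r ^ 2 - y ^ 2) < r := (Real.sqrt_lt' hr).2 (by nlinarith)
    gcongr
  · rintro ⟨hs0, hs1⟩
    rw [lt_div_iff₀ hv] at hs1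
    have hsv : 0 < s * v := by positivity
    have hpos : 0 < r ^ 2 - (s * v / 2) ^ 2 := by nlinarith
    refine ⟨√(r ^ 2 - (s * v / 2) ^ 2), ⟨Real.sqrt_pos.2 hpos,
      (Real.sqrt_lt' hr).2 (by nlinarith)⟩, ?_⟩
    unfold chordTime
    rw [Real.sq_sqrt hpos.le, sub_sub_cancel, Real.sqrt_sq (by positivity)]
    field_simp

lemma hasDerivAt_chordTime {v r y : ℝ} (hy : y ∈ Set.Ioo 0 r) :
    HasDerivAt (chordTime v r) (-(2 * y / (v * √(r ^ 2 - y ^ 2)))) y := by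
  have h : 0 < r ^ 2 - y ^ 2 := by nlinarith [hy.1, hy.2]
  have h1 : HasDerivAt (fun y : ℝ => r ^ 2 - y ^ 2) (-(2 * y)) y := by
    simpa using ((hasDerivAt_id y).pow 2).const_sub (r ^ 2)
  have h2 := ((h1.sqrt h.ne').const_mul 2).div_const v
  unfold chordTime
  have := Real.sqrt_pos.2 h
  refine h2.congr_deriv ?_
  rw [neg_div, mul_neg, neg_div, neg_inj]
  field_simp

lemma injOn_chordTime {v r : ℝ} (hv : 0 < v) : Set.InjOn (chordTime v r) (Set.Ioo 0 r) := by
  intro x hx y hy hxy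
  have h1 : 0 < r ^ 2 - x ^ 2 := by nlinarith [hx.1, hx.2]
  have h2 : 0 < r ^ 2 - y ^ 2 := by nlinarith [hy.1, hy.2]
  unfold chordTime at hxy
  have h3 : √(r ^ 2 - x ^ 2) = √(r ^ 2 - y ^ 2) := by
    field_simp at hxy
    linarith
  rw [Real.sqrt_inj h1.le h2.le] at h3
  exact (sq_eq_sq₀ hx.1.le hy.1.le).1 (by linarith)

lemma measurable_serviceDensity (v r : ℝ) : Measurable (serviceDensity v r) := by
  unfold serviceDensity
  exact Measurable.indicator (by fun_prop) measurableSet_Icc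

/-- The service law is that of the chord time at an offset uniform on `(0, r)`. In the change of
variables, the density at `s = chordTime v r y` is `v √(r² - y²) / (2 r y)` and the Jacobian is `2 y
/ (v √(r² - y²))`; their product is the constant `1 / r`. -/
lemma lintegral_serviceLaw {v r : ℝ} (hv : 0 < v) (hr : 0 < r) {G : ℝ → ENNReal}
    (hG : Measurable G) :
    ∫⁻ s, G s ∂(serviceLaw v r) =
      ENNReal.ofReal (1 / r) * ∫⁻ y in Set.Ioo 0 r, G (chordTime v r y) := by
  rw [serviceLaw, lintegral_withDensity_eq_lintegral_mul _
    (measurable_serviceDensity v r).ennreal_ofReal hG]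
  have e1 : ∫⁻ s, ((fun s => ENNReal.ofReal (serviceDensity v r s)) * G) s =
      ∫⁻ s in Set.Ioo 0 (2 * r / v), ENNReal.ofReal (serviceDensity v r s) * G s := by
    rw [setLIntegral_congr (Ioo_ae_eq_Icc (μ := volume)), ← lintegral_indicator measurableSet_Icc]
    refine lintegral_congr fun s => ?_
    by_cases hs : s ∈ Set.Icc 0 (2 * r / v) <;> simp [serviceDensity, hs]
  rw [e1, ← image_chordTime hv hr, lintegral_image_eq_lintegral_abs_deriv_mul measurableSet_Ioo
    (fun y hy => (hasDerivAt_chordTime hy).hasDerivWithinAt) (injOn_chordTime hv),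
    ← lintegral_const_mul _ (f := fun y => G (chordTime v r y))
      (hG.comp (measurable_chordTime v r))]
  refine setLIntegral_congr_fun measurableSet_Ioo fun y hy => ?_
  have h : 0 < r ^ 2 - y ^ 2 := by nlinarith [hy.1, hy.2]
  have hs := Real.sqrt_pos.2 h
  have hmem : chordTime v r y ∈ Set.Icc 0 (2 * r / v) :=
    Set.Ioo_subset_Icc_self (image_chordTime hv hr ▸ Set.mem_image_of_mem _ hy)
  have hden : √(4 * r ^ 2 - v ^ 2 * chordTime v r y ^ 2) = 2 * y := by
    have : 4 * r ^ 2 - v ^ 2 * chordTime v r y ^ 2 = (2 * y) ^ 2 := by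
      unfold chordTime
      rw [div_pow, mul_pow, Real.sq_sqrt h.le]
      field_simp
      ring
    rw [this, Real.sqrt_sq (by linarith [hy.1])]
  change _ * (_ * _) = _
  rw [← mul_assoc, ← ENNReal.ofReal_mul (abs_nonneg _)]
  congr 2
  rw [serviceDensity, Set.indicator_of_mem hmem, hden, abs_neg,
    abs_of_pos (by have := hy.1; positivity)]
  have := hy.1
  unfold chordTime
  field_simp

/-- The chord time is even in `y`, so both halves of the strip contribute equally. -/
lemma lintegral_chordTime {v r : ℝ} (hv : 0 < v) (hr : 0 < r) {G : ℝ → ENNReal}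
    (hG : Measurable G) :
    ∫⁻ y in Set.Icc (-r) r, G (chordTime v r y) =
      ENNReal.ofReal (2 * r) * ∫⁻ s, G s ∂(serviceLaw v r) := by
  have h1 : ∫⁻ y in Set.Ioc (-r) 0, G (chordTime v r y) =
      ∫⁻ y in Set.Ioo 0 r, G (chordTime v r y) := by
    rw [setLIntegral_congr (Ioo_ae_eq_Ioc (μ := volume)).symm]
    have hm : Measurable fun y => G (chordTime v r y) := hG.comp (measurable_chordTime v r)
    have := (Measure.measurePreserving_neg (volume : Measure ℝ)).setLIntegral_comp_preimage
      (measurableSet_Ioo (a := -r) (b := 0)) hm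
    rw [← this]
    have e : (Neg.neg : ℝ → ℝ) ⁻¹' Set.Ioo (-r) 0 = Set.Ioo 0 r := by
      ext y
      simp only [Set.mem_preimage, Set.mem_Ioo]
      constructor <;> rintro ⟨h1, h2⟩ <;> constructor <;> linarith
    rw [e]
    simp [chordTime]
  rw [setLIntegral_congr (Ioc_ae_eq_Icc (μ := volume)).symm,
    ← Set.Ioc_union_Ioc_eq_Ioc (show -r ≤ 0 by linarith) hr.le,
    lintegral_union measurableSet_Ioc (Set.Ioc_disjoint_Ioc_of_le le_rfl), h1,
    setLIntegral_congr (Ioo_ae_eq_Ioc (μ := volume)).symm, lintegral_serviceLaw hv hr hG,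
    ← mul_assoc, ← ENNReal.ofReal_mul (by positivity), ← two_mul]
  congr 1
  rw [show 2 * r * (1 / r) = 2 by field_simp]
  simp

lemma isProbabilityMeasure_serviceLaw {v r : ℝ} (hv : 0 < v) (hr : 0 < r) :
    IsProbabilityMeasure (serviceLaw v r) := by
  constructor
  rw [← lintegral_one, lintegral_serviceLaw hv hr measurable_const]
  rw [lintegral_one, Measure.restrict_apply_univ, Real.volume_Ioo, sub_zero,
    ← ENNReal.ofReal_mul (by positivity)]
  simp [hr.ne']

end ServiceTime

/-! ### Coordinates along the motion and the image of Lebesgue measure. -/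

section Geometry

/-- The time at which a disc of radius `r`, moving at speed `v` along the first axis and centred at
the origin at time `0`, reaches a point. -/
noncomputable def entranceTime (v r : ℝ) (q : ℝ × ℝ) : ℝ := (q.1 - √(r ^ 2 - q.2 ^ 2)) / v

lemma measurable_entranceTime (v r : ℝ) : Measurable (entranceTime v r) := by
  unfold entranceTime
  fun_prop

/-- On each horizontal line the entrance time is a translation followed by division by `v`, so it
carries length to `v` times length whatever `y` is. Only the chord time retains `y`, and integrating
over `y` gives the factor `2 r` and the service law. -/
lemma map_entranceTime_chordTime {v r : ℝ} (hv : 0 < v) (hr : 0 < r) :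
    (volume.restrict (Set.univ ×ˢ Set.Icc (-r) r)).map
      (fun q : ℝ × ℝ => (entranceTime v r q, chordTime v r q.2)) =
      (ENNReal.ofReal (2 * r * v) • (volume : Measure ℝ)).prod (serviceLaw v r) := by
  have := isProbabilityMeasure_serviceLaw hv hr
  have hg : Measurable fun q : ℝ × ℝ => (entranceTime v r q, chordTime v r q.2) :=
    (measurable_entranceTime v r).prodMk ((measurable_chordTime v r).comp measurable_snd)
  have : SigmaFinite (ENNReal.ofReal (2 * r * v) • (volume : Measure ℝ)) :=
    inferInstanceAs (SigmaFinite ((2 * r * v).toNNReal • (volume : Measure ℝ)))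
  refine (Measure.prod_eq fun A C hA hC => ?_).symm
  rw [Measure.map_apply hg (hA.prod hC), Measure.restrict_apply (hg (hA.prod hC)),
    Measure.volume_eq_prod, Measure.prod_apply_symm ((hg (hA.prod hC)).inter
      (MeasurableSet.univ.prod measurableSet_Icc))]
  have e : ∀ y : ℝ, volume ((fun x => (x, y)) ⁻¹'
      ((fun q : ℝ × ℝ => (entranceTime v r q, chordTime v r q.2)) ⁻¹' A ×ˢ C ∩
        Set.univ ×ˢ Set.Icc (-r) r)) =
      (Set.Icc (-r) r).indicator (fun y => ENNReal.ofReal v * volume A *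
        C.indicator 1 (chordTime v r y)) y := by
    intro y
    by_cases hy : y ∈ Set.Icc (-r) r
    · rw [Set.indicator_of_mem hy]
      by_cases hyC : chordTime v r y ∈ C
      · have : (fun x => (x, y)) ⁻¹' ((fun q : ℝ × ℝ => (entranceTime v r q, chordTime v r q.2)) ⁻¹'
            A ×ˢ C ∩ Set.univ ×ˢ Set.Icc (-r) r) =
            (fun x => x + -√(r ^ 2 - y ^ 2)) ⁻¹' ((fun x => v⁻¹ * x) ⁻¹' A) := by
          ext x
          simp [hy.1, hy.2, hyC, entranceTime, div_eq_inv_mul, sub_eq_add_neg]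
        rw [this, measure_preimage_add_right, Real.volume_preimage_mul_left (by positivity),
          Set.indicator_of_mem hyC, inv_inv, abs_of_pos hv]
        simp
      · rw [Set.indicator_of_notMem hyC, mul_zero]
        convert measure_empty (μ := volume)
        ext x
        simp [hyC]
    · rw [Set.indicator_of_notMem hy]
      convert measure_empty (μ := volume)
      ext x
      simp only [Set.mem_preimage, Set.mem_inter_iff, Set.mem_prod, hy, and_false,
        Set.mem_empty_iff_false]
  simp_rw [e]
  have hind : Measurable (C.indicator (1 : ℝ → ENNReal)) := measurable_one.indicator hC
  rw [lintegral_indicator measurableSet_Icc,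
    lintegral_const_mul _ (f := fun y => C.indicator (1 : ℝ → ENNReal) (chordTime v r y))
      (hind.comp (measurable_chordTime v r)),
    lintegral_chordTime hv hr hind, lintegral_indicator_one hC, Measure.smul_apply, smul_eq_mul,
    ENNReal.ofReal_mul (by positivity : 0 ≤ 2 * r)]
  ring

/-- Orthonormal coordinates of the plane whose first axis has a given direction. -/
lemma exists_measurePreserving_coordinates {u : EuclideanSpace ℝ (Fin 2)} (hu : ‖u‖ = 1) :
    ∃ g : EuclideanSpace ℝ (Fin 2) → ℝ × ℝ, MeasurePreserving g ∧
      ∀ x s, ‖x - s • u‖ ^ 2 = ((g x).1 - s) ^ 2 + (g x).2 ^ 2 := by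
  obtain ⟨b, hb⟩ := Orthonormal.exists_orthonormalBasis_extension_of_card_eq (𝕜 := ℝ)
    (E := EuclideanSpace ℝ (Fin 2)) (ι := Fin 2) (by simp) (v := fun _ => u) (s := {0})
    (by
      constructor
      · intro i
        simpa using hu
      · intro i j hij
        exact absurd (Subsingleton.elim i j) hij)
  have hb0 : b 0 = u := hb 0 rfl
  refine ⟨fun x => (b.repr x 0, b.repr x 1), ?_, fun x s => ?_⟩
  · exact (volume_preserving_finTwoArrow ℝ).comp
      ((EuclideanSpace.volume_preserving_symm_measurableEquiv_toLp (Fin 2)).comp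
        b.measurePreserving_repr)
  · rw [← b.repr.norm_map, map_sub, map_smul, ← hb0, b.repr_self, EuclideanSpace.norm_sq_eq]
    simp [Fin.sum_univ_two]

/-- For `|q.2| ≤ r` the inequality reads `|q.1 - v t| ≤ √(r² - q.2²)`, whose solutions in `t` form
the interval of presence. -/
lemma sq_add_sq_le_sq_iff {v r t : ℝ} (hv : 0 < v) (hr : 0 < r) (q : ℝ × ℝ) :
    (q.1 - v * t) ^ 2 + q.2 ^ 2 ≤ r ^ 2 ↔ q.2 ∈ Set.Icc (-r) r ∧
      t ∈ Set.Icc (entranceTime v r q) (entranceTime v r q + chordTime v r q.2) := by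
  have key : q.2 ∈ Set.Icc (-r) r →
      ((q.1 - v * t) ^ 2 + q.2 ^ 2 ≤ r ^ 2 ↔
        t ∈ Set.Icc (entranceTime v r q) (entranceTime v r q + chordTime v r q.2)) := by
    intro hy
    have h : 0 ≤ r ^ 2 - q.2 ^ 2 := by nlinarith [hy.1, hy.2]
    rw [entranceTime, chordTime, ← add_div, Set.mem_Icc, div_le_iff₀ hv, le_div_iff₀ hv,
      ← le_sub_iff_add_le, Real.sq_le h]
    constructor <;> rintro ⟨h1, h2⟩ <;> constructor <;> nlinarith
  constructor
  · intro h
    have hy : q.2 ∈ Set.Icc (-r) r := abs_le.1 (abs_le_of_sq_le_sq (by nlinarith) hr.le)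
    exact ⟨hy, (key hy).1 h⟩
  · rintro ⟨hy, ht⟩
    exact (key hy).2 ht

end Geometry

/-! ### Stationarity, marginal law and the queue for the moving disc. -/

section MovingDisc

lemma measurableSet_movingDisc (u : EuclideanSpace ℝ (Fin 2)) (v r t : ℝ) :
    MeasurableSet (movingDisc u v r t) := Metric.isClosed_closedBall.measurableSet

lemma volume_movingDisc (u : EuclideanSpace ℝ (Fin 2)) (v : ℝ) {r : ℝ} (hr : 0 ≤ r) (t : ℝ) :
    volume (movingDisc u v r t) = ENNReal.ofReal (Real.pi * r ^ 2) := by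
  rw [movingDisc, EuclideanSpace.volume_closedBall_fin_two, ← ENNReal.ofReal_pow hr,
    ← NNReal.coe_real_pi]
  rw [ENNReal.ofReal_mul (by positivity), ENNReal.ofReal_coe_nnreal, mul_comm]

lemma sub_smul_mem_movingDisc_iff (u : EuclideanSpace ℝ (Fin 2)) (v r t h : ℝ)
    (x : EuclideanSpace ℝ (Fin 2)) :
    x - (v * h) • u ∈ movingDisc u v r t ↔ x ∈ movingDisc u v r (t + h) := by
  rw [movingDisc, movingDisc, mem_closedBall_iff_norm, mem_closedBall_iff_norm, mul_add, add_smul,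
    sub_sub, add_comm]

variable {Ω : Type*} [MeasurableSpace Ω] {P : Measure Ω}
  {Φ : Ω → Set (EuclideanSpace ℝ (Fin 2))} {lam : ℝ}

/-- The law of the numbers of points in a moving disc does not depend on the time origin. -/
lemma identDistrib_nodeCount_add [IsProbabilityMeasure P] (hΦ : IsPoissonPointProcess Φ lam P)
    (hlam : 0 ≤ lam) (u : EuclideanSpace ℝ (Fin 2)) (v : ℝ) {r : ℝ} (hr : 0 ≤ r) (h : ℝ) :
    IdentDistrib (fun ω (t : ℝ≥0) => nodeCount Φ u v r (t + h) ω)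
      (fun ω (t : ℝ≥0) => nodeCount Φ u v r t ω) P P := by
  have hm : Measurable fun ω (t : ℝ≥0) => nodeCount Φ u v r (t + h) ω :=
    measurable_pi_lambda _ fun t => hΦ.measurable_count _ (measurableSet_movingDisc u v r _)
  have hm0 : Measurable fun ω (t : ℝ≥0) => nodeCount Φ u v r t ω :=
    measurable_pi_lambda _ fun t => hΦ.measurable_count _ (measurableSet_movingDisc u v r _)
  have hvol : ∀ t, volume (movingDisc u v r t) ≠ ⊤ := fun t => by
    rw [volume_movingDisc u v hr t]
    exact ENNReal.ofReal_ne_top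
  have hfin : ∀ t, ∀ᵐ ω ∂P, nodeCount Φ u v r t ω ≠ ⊤ := fun t =>
    ae_ne_top_of_hasLaw_poissonENat
      (hΦ.hasLaw_count _ (measurableSet_movingDisc u v r t) (hvol t))
  refine ⟨hm.aemeasurable, hm0.aemeasurable, ?_⟩
  refine map_eq_of_integral_exp_toNat_eq hm hm0 (fun t => hfin _) (fun t => hfin _)
    fun J θ => ?_
  have e := hΦ.integral_exp_count hlam
    (B := fun j : J => movingDisc u v r ((j : ℝ≥0) + h))
    (fun j => measurableSet_movingDisc u v r _) (fun j => hvol _) θ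
  have e0 := hΦ.integral_exp_count hlam (B := fun j : J => movingDisc u v r (j : ℝ≥0))
    (fun j => measurableSet_movingDisc u v r _) (fun j => hvol _) θ
  refine e.trans (Eq.trans ?_ e0.symm)
  congr 2
  -- Translation by `(v * h) • u` carries each disc at time `t` to the disc at time `t + h` and
  -- preserves volume, so the two exponents coincide.
  rw [← integral_sub_right_eq_self (fun x => Complex.exp ((∑ j : J, θ j *
    (movingDisc u v r (j : ℝ≥0)).indicator (1 : EuclideanSpace ℝ (Fin 2) → ℝ) x : ℝ) * Complex.I) - 1) ((v * h) • u)]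
  refine integral_congr_ae (.of_forall fun x => ?_)
  have hj : ∀ j : J, (movingDisc u v r ((j : ℝ≥0) + h)).indicator (1 : EuclideanSpace ℝ (Fin 2) → ℝ) x =
      (movingDisc u v r (j : ℝ≥0)).indicator (1 : EuclideanSpace ℝ (Fin 2) → ℝ) (x - (v * h) • u) := by
    intro j
    classical
    simp only [Set.indicator_apply, sub_smul_mem_movingDisc_iff, Pi.one_apply]
  simp only [hj]

lemma hasLaw_nodeCount (hΦ : IsPoissonPointProcess Φ lam P) (u : EuclideanSpace ℝ (Fin 2))
    (v : ℝ) {r : ℝ} (hr : 0 ≤ r) (t : ℝ) :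
    HasLaw (nodeCount Φ u v r t) (poissonENat (lam * Real.pi * r ^ 2)) P := by
  have h := hΦ.hasLaw_count _ (measurableSet_movingDisc u v r t)
    (by rw [volume_movingDisc u v hr]; exact ENNReal.ofReal_ne_top)
  rwa [volume_movingDisc u v hr, ENNReal.toReal_ofReal (by positivity), ← mul_assoc] at h

/-- The nodes met by a moving disc are the customers of a stationary `M/GI/∞` queue. -/
lemma exists_queue_of_movingDisc [IsProbabilityMeasure P] (hΦ : IsPoissonPointProcess Φ lam P)
    (hlam : 0 < lam) {u : EuclideanSpace ℝ (Fin 2)} (hu : ‖u‖ = 1) {v r : ℝ} (hv : 0 < v)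
    (hr : 0 < r) :
    ∃ (T S : ℤ → Ω → ℝ) (X : ℤ → Ω → EuclideanSpace ℝ (Fin 2)),
      IsStationaryMGIInfinityQueue T S (2 * r * v * lam) (serviceLaw v r) P ∧
      (∀ᵐ ω ∂P, Function.Injective (fun n => X n ω) ∧
        Set.range (fun n => X n ω) = {x ∈ Φ ω | ∃ t : ℝ, x ∈ movingDisc u v r t} ∧
        ∀ n, {t : ℝ | X n ω ∈ movingDisc u v r t} = Set.Icc (T n ω) (T n ω + S n ω)) := by
  obtain ⟨g, hg, hgu⟩ := exists_measurePreserving_coordinates hu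
  have := isProbabilityMeasure_serviceLaw hv hr
  have hmem : ∀ x t, x ∈ movingDisc u v r t ↔ (g x).2 ∈ Set.Icc (-r) r ∧
      t ∈ Set.Icc (entranceTime v r (g x)) (entranceTime v r (g x) + chordTime v r (g x).2) := by
    intro x t
    rw [← sq_add_sq_le_sq_iff hv hr, ← hgu, movingDisc, mem_closedBall_iff_norm,
      sq_le_sq₀ (norm_nonneg _) hr.le]
  have hZ0 : MeasurableSet (Set.univ ×ˢ Set.Icc (-r) r : Set (ℝ × ℝ)) :=
    MeasurableSet.univ.prod measurableSet_Icc
  have hm : Measurable fun q : ℝ × ℝ => (entranceTime v r q, chordTime v r q.2) :=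
    (measurable_entranceTime v r).prodMk ((measurable_chordTime v r).comp measurable_snd)
  obtain ⟨T, S, X, hQ, hX⟩ := hΦ.exists_isStationaryMGIInfinityQueue hlam
    (κ := 2 * r * v) (by positivity) (hg.measurable hZ0)
    (τ := fun x => entranceTime v r (g x)) (σ := fun x => chordTime v r (g x).2)
    ((measurable_entranceTime v r).comp hg.measurable)
    ((measurable_chordTime v r).comp (measurable_snd.comp hg.measurable)) (serviceLaw v r)
    (by
      rw [← map_entranceTime_chordTime hv hr, ← (hg.restrict_preimage hZ0).map_eq,
        Measure.map_map hm hg.measurable]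
      rfl)
  refine ⟨T, S, X, by rwa [mul_comm lam] at hQ, ?_⟩
  filter_upwards [hX] with ω hω
  obtain ⟨h1, h2, h3⟩ := hω
  refine ⟨h1, ?_, fun n => ?_⟩
  · rw [h2]
    ext x
    simp only [Set.mem_inter_iff, Set.mem_preimage, Set.mem_prod, Set.mem_univ, true_and,
      Set.mem_ofPred_eq, hmem, exists_and_left]
    refine and_congr_right fun _ => (and_iff_left ?_).symm
    -- Every point of the strip is met, for instance at its entrance time.
    refine ⟨entranceTime v r (g x), le_rfl, le_add_of_nonneg_right ?_⟩
    unfold chordTime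
    positivity
  · have hn : X n ω ∈ Φ ω ∩ g ⁻¹' (Set.univ ×ˢ Set.Icc (-r) r) := h2 ▸ Set.mem_range_self n
    ext t
    rw [Set.mem_ofPred_eq, hmem, (h3 n).1, (h3 n).2]
    exact and_iff_right hn.2.2

end MovingDisc

theorem mainTheorem2 {Ω : Type*} [MeasurableSpace Ω] (P : Measure Ω) [IsProbabilityMeasure P]
    (lam v p w β γ r : ℝ) (hlam : 0 < lam) (hv : 0 < v) (hp : 0 < p) (hw : 0 < w) (hβ : 2 < β)
    (hγ : 0 < γ) (hr : r = coverageRadius p w β γ)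
    (u : EuclideanSpace ℝ (Fin 2)) (hu : ‖u‖ = 1)
    (Φ : Ω → Set (EuclideanSpace ℝ (Fin 2))) (hΦ : IsPoissonPointProcess Φ lam P) :
    -- the node count is the number of customers in an `M/GI/∞` queue, whose customers are the
    -- nodes met by the disc, present exactly while they are in the disc
    (∃ (T S : ℤ → Ω → ℝ) (X : ℤ → Ω → EuclideanSpace ℝ (Fin 2)),
      IsStationaryMGIInfinityQueue T S (2 * r * v * lam) (serviceLaw v r) P ∧
      (∀ᵐ ω ∂P, ∀ t : ℝ, 0 ≤ t → nodeCount Φ u v r t ω = numCustomers T S t ω) ∧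
      (∀ᵐ ω ∂P, Function.Injective (fun n => X n ω) ∧
        Set.range (fun n => X n ω) = {x ∈ Φ ω | ∃ t : ℝ, x ∈ movingDisc u v r t} ∧
        ∀ n, {t : ℝ | X n ω ∈ movingDisc u v r t} = Set.Icc (T n ω) (T n ω + S n ω))) ∧
    -- the node count is a stationary process
    (∀ h : ℝ, 0 ≤ h → IdentDistrib
      (fun ω (t : ℝ≥0) => nodeCount Φ u v r (t + h) ω)
      (fun ω (t : ℝ≥0) => nodeCount Φ u v r t ω) P P) ∧
    -- its stationary distribution is Poisson
    (∀ t : ℝ, 0 ≤ t → HasLaw (nodeCount Φ u v r t) (poissonENat (lam * Real.pi * r ^ 2)) P) := by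
  have hr0 : 0 < r := by
    rw [hr, coverageRadius]
    positivity
  refine ⟨?_, fun h _ => identDistrib_nodeCount_add hΦ hlam.le u v hr0.le h,
    fun t _ => hasLaw_nodeCount hΦ u v hr0.le t⟩
  obtain ⟨T, S, X, hQ, hX⟩ := exists_queue_of_movingDisc hΦ hlam hu hv hr0
  refine ⟨T, S, X, hQ, ?_, hX⟩
  filter_upwards [hX] with ω hω t _
  obtain ⟨h1, h2, h3⟩ := hω
  have h3' : ∀ n, X n ω ∈ movingDisc u v r t ↔ T n ω ≤ t ∧ t ≤ T n ω + S n ω := fun n =>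
    Set.ext_iff.1 (h3 n) t
  -- `X` is injective, so counting customers present at `t` is counting their nodes, which are the
  -- nodes in the disc at time `t`.
  rw [nodeCount, numCustomers, ← h1.encard_image]
  congr 1
  ext x
  constructor
  · rintro ⟨hx, hxt⟩
    obtain ⟨n, rfl⟩ : x ∈ Set.range fun n => X n ω := h2 ▸ ⟨hx, t, hxt⟩
    exact ⟨n, (h3' n).1 hxt, rfl⟩
  · rintro ⟨n, hn, rfl⟩
    have : X n ω ∈ {x ∈ Φ ω | ∃ t : ℝ, x ∈ movingDisc u v r t} := h2 ▸ ⟨n, rfl⟩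
    exact ⟨this.1, (h3' n).2 hn⟩
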